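/- Let $k$ be an algebraically closed field and let $V$ be a 4-dimensional $k$-vector space. For $d\in\{6,8\}$ let $\mathsf{G}(d,V^{\otimes 2})$ be the Grassmannian of $d$-dimensional subspaces of $V^{\otimes 2}=V\otimes_k V$, viewed as a $k$-scheme through its Plücker embedding in $\mathbb{P}(\wedge^d(V^{\otimes 2}))$. Let $$\mathbf{S}=\{(R,W)\;|\;W\cap R\ne 0\}\;\subseteq\;\mathsf{G}(6,V^{\otimes 2})\times_k\mathsf{G}(8,V^{\otimes 2})$$ be the incidence variety, i.e. the reduced closed subscheme whose closed points are the pairs $(R,W)$, with $R,W\subseteq V^{\otimes 2}$ subspaces of dimensions $6$ and $8$, such that $W\cap R\neq 0$. Then the morphism $\mathbf{S}\to\mathsf{G}(6,V^{\otimes 2})$, $(R,W)\mapsto R$, is flat. -/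

import Mathlib

open scoped TensorProduct

universe u

noncomputable section

namespace Plucker

variable (k : Type u) [Field k] (E : Type u) [AddCommGroup E] [Module k E] (d : ℕ)

/-- The linear map that regards an alternating `d`-form on `E` as a function of a `d`-tuple of
vectors. For `E = kⁿ` the values of this map are the linear combinations of the maximal minors
(the Plücker coordinates) of an `n × d` matrix. -/
def formToFun : (E [⋀^Fin d]→ₗ[k] k) →ₗ[k] ((Fin d → E) → k) where
  toFun ω := fun v => ω v
  map_add' _ _ := rfl
  map_smul' _ _ := rfl

/-- The space of Plücker linear forms: the functions on `d`-tuples of vectors of `E` that are given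
by alternating `d`-forms. -/
def linearForms : Submodule k ((Fin d → E) → k) := LinearMap.range (formToFun k E d)

/-- The Plücker algebra, i.e. the homogeneous coordinate ring of the Grassmannian of `d`-dimensional
subspaces of `E` in its Plücker embedding into `ℙ(Λ^d E)`: the algebra of functions on `d`-tuples
of vectors generated by the Plücker coordinates. (Over an infinite field, polynomial functions are
the same as polynomials.) -/
abbrev coordRing : Subalgebra k ((Fin d → E) → k) :=
  Algebra.adjoin k (linearForms k E d : Set ((Fin d → E) → k))

/-- The degree `m` part of the Plücker algebra: the span of all products of `m` Plücker
linear forms. -/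
def grading (m : ℕ) : Submodule k (coordRing k E d) :=
  ((linearForms k E d) ^ m).comap (coordRing k E d).val.toLinearMap

variable {k E d}

theorem linearForms_le : linearForms k E d ≤ Subalgebra.toSubmodule (coordRing k E d) :=
  fun _ hx => Algebra.subset_adjoin hx

theorem linearForms_pow_le (m : ℕ) :
    (linearForms k E d) ^ m ≤ Subalgebra.toSubmodule (coordRing k E d) := by
  induction m with
  | zero =>
    rw [pow_zero, Submodule.one_le]
    exact one_mem (coordRing k E d)
  | succ m ih =>
    rw [pow_succ, Submodule.mul_le]
    intro a ha b hb
    exact mul_mem (S := Subalgebra k ((Fin d → E) → k)) (ih ha) (linearForms_le hb)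

theorem mem_grading {m : ℕ} {f : coordRing k E d} :
    f ∈ grading k E d m ↔ (f : (Fin d → E) → k) ∈ (linearForms k E d) ^ m := Iff.rfl

/-- If the values of all alternating forms at `v'` are `c` times their values at `v`, then elements
of degree `m` of the Plücker algebra are multiplied by `c ^ m`. -/
theorem apply_eq_pow_mul {v v' : Fin d → E} {c : k}
    (h : ∀ ω : E [⋀^Fin d]→ₗ[k] k, ω v' = c * ω v) (m : ℕ) {f : (Fin d → E) → k}
    (hf : f ∈ (linearForms k E d) ^ m) : f v' = c ^ m * f v := by
  induction m generalizing f with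
  | zero =>
    rw [pow_zero, Submodule.mem_one] at hf
    obtain ⟨a, rfl⟩ := hf
    simp [Pi.algebraMap_apply]
  | succ m ih =>
    rw [pow_succ] at hf
    induction hf using Submodule.mul_induction_on' with
    | mem_mul_mem a ha b hb =>
      obtain ⟨ω, rfl⟩ := hb
      have h1 := ih ha
      have h2 : formToFun k E d ω v' = c * formToFun k E d ω v := h ω
      rw [Pi.mul_apply, Pi.mul_apply, h1, h2]
      ring
    | add x _ y _ hx hy =>
      rw [Pi.add_apply, Pi.add_apply, hx, hy]
      ring

theorem apply_smul (t : k) (v : Fin d → E) (m : ℕ) {f : (Fin d → E) → k}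
    (hf : f ∈ (linearForms k E d) ^ m) : f (t • v) = (t ^ d) ^ m * f v := by
  refine apply_eq_pow_mul (fun ω => ?_) m hf
  have := ω.map_smul_univ (fun _ => t) v
  rw [Finset.prod_const, Finset.card_univ, Fintype.card_fin, smul_eq_mul] at this
  exact this

/-- A finite sum of elements of pairwise different degrees which vanishes at all multiples of `v`
has summands that vanish at `v`. -/
theorem apply_eq_zero_of_sum [Infinite k] [NeZero d] (s : Finset ℕ) (f : ℕ → (Fin d → E) → k)
    (hf : ∀ m ∈ s, f m ∈ (linearForms k E d) ^ m) (v : Fin d → E)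
    (h : ∀ t : k, ∑ m ∈ s, f m (t • v) = 0) {m : ℕ} (hm : m ∈ s) : f m v = 0 := by
  classical
  let p : Polynomial k := ∑ m ∈ s, Polynomial.monomial (d * m) (f m v)
  have hp : p = 0 := by
    refine Polynomial.funext fun t => ?_
    have := h t
    rw [Polynomial.eval_zero, ← this, Polynomial.eval_finsetSum]
    refine Finset.sum_congr rfl fun i hi => ?_
    rw [Polynomial.eval_monomial, apply_smul t v i (hf i hi), pow_mul, mul_comm]
  have hc : p.coeff (d * m) = f m v := by
    rw [Polynomial.finsetSum_coeff, Finset.sum_eq_single m]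
    · simp
    · intro i _ him
      rw [Polynomial.coeff_monomial, if_neg]
      intro hh
      exact him (Nat.eq_of_mul_eq_mul_left (Nat.pos_of_neZero d) hh)
    · exact fun hm' => absurd hm hm'
  rw [← hc, hp, Polynomial.coeff_zero]

instance : SetLike.GradedMonoid (grading k E d) where
  one_mem := by
    rw [mem_grading, pow_zero]
    exact Submodule.one_le.mp le_rfl
  mul_mem i j a b ha hb := by
    rw [mem_grading] at *
    rw [pow_add]
    exact Submodule.mul_mem_mul ha hb

theorem iSup_grading : ⨆ m, grading k E d m = ⊤ := by
  rw [eq_top_iff]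
  rintro ⟨f, hf⟩ -
  induction hf using Algebra.adjoin_induction with
  | mem x hx =>
    refine Submodule.mem_iSup_of_mem 1 ?_
    rw [mem_grading, pow_one]
    exact hx
  | algebraMap r =>
    refine Submodule.mem_iSup_of_mem 0 ?_
    rw [mem_grading, pow_zero, Submodule.mem_one]
    exact ⟨r, rfl⟩
  | add x y hx hy h1 h2 => exact add_mem h1 h2
  | mul x y hx hy h1 h2 =>
    have key : ∀ a ∈ ⨆ m, grading k E d m, ∀ b ∈ ⨆ m, grading k E d m,
        a * b ∈ ⨆ m, grading k E d m := by
      intro a ha b hb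
      induction ha using Submodule.iSup_induction' with
      | mem i a ha =>
        induction hb using Submodule.iSup_induction' with
        | mem j b hb => exact Submodule.mem_iSup_of_mem (i + j) (SetLike.mul_mem_graded ha hb)
        | zero => rw [mul_zero]; exact zero_mem _
        | add b b' _ _ h h' => rw [mul_add]; exact add_mem h h'
      | zero => rw [zero_mul]; exact zero_mem _
      | add a a' _ _ h h' => rw [add_mul]; exact add_mem h h'
    exact key _ h1 _ h2

theorem iSupIndep_grading [Infinite k] [NeZero d] : iSupIndep (grading k E d) := by
  classical
  rw [iSupIndep_iff_forall_dfinsupp]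
  intro i x y hxy
  let F : ℕ → (Fin d → E) → k := fun m =>
    if m = i then -((x : coordRing k E d) : (Fin d → E) → k)
    else ((y m : coordRing k E d) : (Fin d → E) → k)
  have hF : ∀ m ∈ insert i (y.erase i).support, F m ∈ (linearForms k E d) ^ m := by
    intro m _
    by_cases hm : m = i
    · subst hm
      have hx := mem_grading.mp x.2
      simpa only [F, if_true] using neg_mem hx
    · have hy := mem_grading.mp (y m).2
      simpa only [F, if_neg hm] using hy
  have hsum : ((x : coordRing k E d) : (Fin d → E) → k) =
      ∑ m ∈ (y.erase i).support, ((y m : coordRing k E d) : (Fin d → E) → k) := by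
    rw [DFinsupp.lsum_apply_apply, DFinsupp.sumAddHom_apply] at hxy
    have h1 := congrArg (coordRing k E d).val hxy
    rw [DFinsupp.sum, map_sum] at h1
    refine h1.symm.trans (Finset.sum_congr rfl fun m hm => ?_)
    have hmi : m ≠ i := by
      rintro rfl
      simp at hm
    rw [DFinsupp.erase_ne hmi]
    rfl
  have hi : i ∉ (y.erase i).support := by simp
  have h0 : ∀ v, F i v = 0 := fun v => by
    refine apply_eq_zero_of_sum _ F hF v (fun t => ?_) (Finset.mem_insert_self _ _)
    rw [Finset.sum_insert hi]
    have h2 := congrFun hsum (t • v)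
    rw [Finset.sum_apply] at h2
    have h3 : ∀ m ∈ (y.erase i).support,
        F m (t • v) = ((y m : coordRing k E d) : (Fin d → E) → k) (t • v) := by
      intro m hm
      have hmi : m ≠ i := by
        rintro rfl
        exact hi hm
      simp [F, hmi]
    rw [Finset.sum_congr rfl h3, ← h2]
    simp [F]
  apply Subtype.ext
  apply Subtype.ext
  funext v
  have := h0 v
  simpa [F] using this

instance [Infinite k] [NeZero d] : GradedAlgebra (grading k E d) :=
  { toDecomposition := (DirectSum.isInternal_submodule_of_iSupIndep_of_iSup_eq_top
      iSupIndep_grading iSup_grading).chooseDecomposition }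

end Plucker

open AlgebraicGeometry CategoryTheory CategoryTheory.Limits Plucker

namespace Grassmannian

section

variable (k : Type u) [Field k] [Infinite k] (d : ℕ) [NeZero d]
  (E : Type u) [AddCommGroup E] [Module k E]

/-- The Grassmannian `G(d, E)` of `d`-dimensional subspaces of `E` as a scheme, realised by its
Plücker embedding. -/
abbrev scheme : Scheme.{u} := Proj (grading k E d)

/-- The structure morphism `G(d, E) ⟶ Spec k`. -/
def toSpec : scheme k d E ⟶ Spec (.of k) :=
  Proj.toSpecZero (grading k E d) ≫
    Spec.map (CommRingCat.ofHom (algebraMap k (grading k E d 0)))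

end

section

variable {k : Type u} [Field k] {d : ℕ} {E : Type u} [AddCommGroup E] [Module k E]

/-- The ideal of all elements of the Plücker algebra which vanish on all `d`-tuples of vectors of
the subspace `W`. -/
def ideal (d : ℕ) (W : Submodule k E) : Ideal (coordRing k E d) where
  carrier := {f | ∀ v : Fin d → E, (∀ i, v i ∈ W) → (f : (Fin d → E) → k) v = 0}
  zero_mem' := fun _ _ => rfl
  add_mem' := fun {a b} ha hb v hv => by simp [ha v hv, hb v hv]
  smul_mem' := fun c f hf v hv => by simp [hf v hv]

theorem mem_ideal {W : Submodule k E} {f : coordRing k E d} :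
    f ∈ ideal d W ↔ ∀ v : Fin d → E, (∀ i, v i ∈ W) → (f : (Fin d → E) → k) v = 0 := Iff.rfl

theorem ideal_isHomogeneous [Infinite k] [NeZero d] (W : Submodule k E) :
    (ideal d W).IsHomogeneous (grading k E d) := by
  classical
  intro i f hf
  rw [mem_ideal] at hf ⊢
  intro v hv
  by_cases hi : i ∈ (DirectSum.decompose (grading k E d) f).support
  · refine apply_eq_zero_of_sum (DirectSum.decompose (grading k E d) f).support
      (fun m => ((DirectSum.decompose (grading k E d) f m : coordRing k E d) : (Fin d → E) → k))
      (fun m _ => (DirectSum.decompose (grading k E d) f m).2) v (fun t => ?_) hi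
    have h1 := congrArg (coordRing k E d).val (DirectSum.sum_support_decompose (grading k E d) f)
    have h2 := congrFun h1 (t • v)
    have h3 := hf (t • v) (fun j => W.smul_mem t (hv j))
    rw [← h3]
    simpa using h2
  · have : DirectSum.decompose (grading k E d) f i = 0 := by simpa using hi
    rw [this]
    rfl

/-- A homogeneous element vanishes on all tuples in `W` as soon as it vanishes at a basis. -/
theorem mem_ideal_of_basis {W : Submodule k E} (e : Module.Basis (Fin d) k W) {m : ℕ}
    {f : coordRing k E d} (hf : f ∈ grading k E d m)
    (h : (f : (Fin d → E) → k) (fun i => (e i : E)) = 0) : f ∈ ideal d W := by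
  rw [mem_ideal]
  intro v hv
  have hf' : (f : (Fin d → E) → k) ∈ (linearForms k E d) ^ m := hf
  rw [apply_eq_pow_mul (v := fun i => (e i : E)) (c := e.det fun i => (⟨v i, hv i⟩ : W))
    (fun ω => ?_) m hf', h, mul_zero]
  have := congrArg (fun η : W [⋀^Fin d]→ₗ[k] k => η fun i => (⟨v i, hv i⟩ : W))
    ((ω.compLinearMap W.subtype).eq_smul_basis_det e)
  simp only [AlternatingMap.compLinearMap_apply, AlternatingMap.smul_apply, smul_eq_mul] at this
  rw [mul_comm]
  exact this

theorem ideal_isPrime [Infinite k] [NeZero d] (W : Submodule k E) (hW : Module.finrank k W = d) :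
    (ideal d W).IsPrime := by
  have : Module.Finite k W := Module.finite_of_finrank_pos (hW ▸ Nat.pos_of_neZero d)
  let e := Module.finBasisOfFinrankEq k W hW
  refine (ideal_isHomogeneous W).isPrime_of_homogeneous_mem_or_mem ?_ ?_
  · rw [Ideal.ne_top_iff_one, mem_ideal]
    intro h
    exact one_ne_zero (h (fun _ => 0) (fun _ => W.zero_mem))
  · rintro x y ⟨i, hx⟩ ⟨j, hy⟩ hxy
    have h := hxy (fun i => (e i : E)) (fun i => (e i).2)
    rcases mul_eq_zero.mp h with h | h
    · exact Or.inl (mem_ideal_of_basis e hx h)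
    · exact Or.inr (mem_ideal_of_basis e hy h)

theorem not_irrelevant_le [Infinite k] [NeZero d] (W : Submodule k E)
    (hW : Module.finrank k W = d) :
    ¬ HomogeneousIdeal.irrelevant (grading k E d) ≤ ⟨ideal d W, ideal_isHomogeneous W⟩ := by
  have : Module.Finite k W := Module.finite_of_finrank_pos (hW ▸ Nat.pos_of_neZero d)
  let e := Module.finBasisOfFinrankEq k W hW
  obtain ⟨p, hp⟩ := W.subtype.exists_leftInverse_of_injective W.ker_subtype
  let ω : E [⋀^Fin d]→ₗ[k] k := e.det.compLinearMap p
  have hω : formToFun k E d ω ∈ linearForms k E d := ⟨ω, rfl⟩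
  let f : coordRing k E d := ⟨formToFun k E d ω, linearForms_le hω⟩
  have hf : f ∈ grading k E d 1 := by
    rw [mem_grading, pow_one]
    exact hω
  intro hle
  have h1 : f ∈ HomogeneousIdeal.irrelevant (grading k E d) :=
    HomogeneousIdeal.mem_irrelevant_of_mem _ one_pos hf
  have h2 : f ∈ ideal d W := hle h1
  have h3 : e.det (fun i => p (e i : E)) = 0 := h2 (fun i => (e i : E)) (fun i => (e i).2)
  have h4 : (fun i => p (e i : E)) = e := funext fun i => LinearMap.congr_fun hp (e i)
  rw [h4, e.det_self] at h3
  exact one_ne_zero h3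

/-- The closed point of the Grassmannian given by a `d`-dimensional subspace `W` of `E`. -/
def point [Infinite k] [NeZero d] (W : Submodule k E) (hW : Module.finrank k W = d) :
    scheme k d E :=
  show ProjectiveSpectrum (grading k E d) from
    { asHomogeneousIdeal := ⟨ideal d W, ideal_isHomogeneous W⟩
      isPrime := ideal_isPrime W hW
      not_irrelevant_le := not_irrelevant_le W hW }

end

end Grassmannian

namespace Incidence

variable (k : Type u) [Field k] [IsAlgClosed k] (V : Type u) [AddCommGroup V] [Module k V]

/-- The product `G(6, V ⊗ V) × G(8, V ⊗ V)` over `k`. -/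
abbrev ambient : Scheme.{u} :=
  pullback (Grassmannian.toSpec k 6 (V ⊗[k] V)) (Grassmannian.toSpec k 8 (V ⊗[k] V))

/-- The projection `G(6, V ⊗ V) × G(8, V ⊗ V) ⟶ G(6, V ⊗ V)`. -/
abbrev proj₁ : ambient k V ⟶ Grassmannian.scheme k 6 (V ⊗[k] V) := pullback.fst _ _

/-- The projection `G(6, V ⊗ V) × G(8, V ⊗ V) ⟶ G(8, V ⊗ V)`. -/
abbrev proj₂ : ambient k V ⟶ Grassmannian.scheme k 8 (V ⊗[k] V) := pullback.snd _ _

/-- The set of closed points `(R, W)` of `G(6, V ⊗ V) × G(8, V ⊗ V)` with `W ∩ R ≠ 0`. -/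
def closedPoints : Set (ambient k V) :=
  {x | ∃ (R W : Submodule k (V ⊗[k] V)) (hR : Module.finrank k R = 6)
      (hW : Module.finrank k W = 8),
      W ⊓ R ≠ ⊥ ∧ proj₁ k V x = Grassmannian.point R hR ∧ proj₂ k V x = Grassmannian.point W hW}

/-- The ideal sheaf of all functions vanishing at all `(R, W)` with `W ∩ R ≠ 0`. -/
abbrev idealSheaf : (ambient k V).IdealSheafData :=
  Scheme.IdealSheafData.vanishingIdeal (TopologicalSpace.Closeds.closure (closedPoints k V))

/-- The incidence variety `S = {(R, W) | W ∩ R ≠ 0}`, i.e. the reduced closed subscheme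
of `G(6, V ⊗ V) × G(8, V ⊗ V)` whose closed points are the pairs `(R, W)` with `W ∩ R ≠ 0`.
These form a closed subset of the set of all closed points, so that the closure only adds the
non-closed points. -/
abbrev scheme : Scheme.{u} := (idealSheaf k V).subscheme

/-- The closed immersion of `S` into `G(6, V ⊗ V) × G(8, V ⊗ V)`. -/
abbrev ι : scheme k V ⟶ ambient k V := (idealSheaf k V).subschemeι

/-- The restriction to `S` of the projection to `G(6, V ⊗ V)`. -/
abbrev toBase : scheme k V ⟶ Grassmannian.scheme k 6 (V ⊗[k] V) := ι k V ≫ proj₁ k V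

end Incidence

end

/-!
The projection from the incidence variety `S` to `G(6, E)`, `E = V ⊗ V`, is flat because `S` is a
product over suitable open sets, compatibly with the projection.

Let `f₁, …, f₈` be linear forms on `E`. The subspaces `R` of dimension `6` on which `f₁, …, f₆`
restrict to a basis of the dual space form an affine chart of `G(6, E)`, and so do the subspaces `W`
of dimension `8` on which `f₁, …, f₈` do so in `G(8, E)`. Such a subspace has a unique basis that is
dual to the forms (a `Grassmannian.Frame`), and the coordinate ring of the chart is the algebra of
polynomial functions of this basis (`Grassmannian.awayEquiv`). Because both charts come from one
flag of linear forms, the group of all automorphisms `x ↦ x + ∑ f_i(x) c_i`, with `i ≤ 6` and `c_i`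
in the common kernel of `f₁, …, f₆`, acts simply transitively on the first chart and preserves the
second one. Hence, for a base point `R₀` of the first chart, there are bijections `Φ_R` of the second
one, polynomial in `R` together with their inverses, such that `W` meets `R₀` non-trivially if and
only if `Φ_R W` meets `R` non-trivially (`Grassmannian.transport_mem_incident`).

If `A` and `B` are the coordinate rings of the two charts and `C` is the algebra of the restrictions
of elements of `B` to the set of all `W` that meet `R₀`, then `Φ` gives a surjection `A ⊗ B → A ⊗ C`
whose kernel consists of the functions that vanish on the incidence variety
(`FunctionAlgebra.exists_trivialization`). So `S` is `Spec (A ⊗ C)` in the product of the charts,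
and `A ⊗ C` is flat over `A` since `C` is flat over the field `k`. All of this uses only that tensor
products of algebras of functions are algebras of functions on the product
(`FunctionAlgebra.tensorToFun_injective`).

Products of such charts cover `G(6, E) × G(8, E)`: for arbitrary points of the two Grassmannians,
closed or not, there are linear forms for which `f₁ ∧ ⋯ ∧ f₆` does not vanish at the first point and
`f₁ ∧ ⋯ ∧ f₈` does not vanish at the second one. Indeed the decomposable forms span all alternating
forms, and the two conditions on `f₁, …, f₈` are multi-affine and can each be satisfied
(`Plucker.exists_detForm_notMem`).
-/

section

open AlgebraicGeometry CategoryTheory CategoryTheory.Limits Plucker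

/-! ### Decomposable alternating forms -/

namespace Plucker

section Decomposable

variable {k : Type*} [Field k] {E : Type*} [AddCommGroup E] [Module k E] {d : ℕ}

/-- The decomposable alternating form `f₁ ∧ ⋯ ∧ f_d`, that is `v ↦ det (f_j (v_i))`. -/
noncomputable def detForm (f : Fin d → Module.Dual k E) : E [⋀^Fin d]→ₗ[k] k :=
  Matrix.detRowAlternating.compLinearMap (LinearMap.pi f)

theorem detForm_apply (f : Fin d → Module.Dual k E) (v : Fin d → E) :
    detForm f v = (Matrix.of fun i j => f j (v i)).det := rfl

/-- Decomposable forms depend multilinearly on their factors. -/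
theorem detForm_update_lineMap (f : Fin d → Module.Dual k E) (i : Fin d) (x y : Module.Dual k E)
    (t : k) :
    detForm (Function.update f i (x + t • (y - x))) =
      detForm (Function.update f i x) +
        t • (detForm (Function.update f i y) - detForm (Function.update f i x)) := by
  have key : ∀ (z : Module.Dual k E) (v : Fin d → E), detForm (Function.update f i z) v =
      ((Matrix.of fun a j => f j (v a)).updateCol i fun a => z (v a)).det := by
    intro z v
    rw [detForm_apply]
    congr 1
    ext a j
    by_cases h : j = i
    · subst h; simp
    · simp [h]
  ext v
  simp only [AlternatingMap.add_apply, AlternatingMap.smul_apply, AlternatingMap.sub_apply, key]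
  have h1 : (fun a => (x + t • (y - x)) (v a)) =
      (fun a => x (v a)) + t • ((fun a => y (v a)) + (-1 : k) • fun a => x (v a)) := by
    ext a
    simp only [LinearMap.add_apply, LinearMap.smul_apply, LinearMap.sub_apply, Pi.add_apply,
      Pi.smul_apply, smul_eq_mul]
    ring
  rw [h1, Matrix.det_updateCol_add, Matrix.det_updateCol_smul, Matrix.det_updateCol_add,
    Matrix.det_updateCol_smul]
  simp only [smul_eq_mul]
  ring

theorem span_range_detForm [Module.Finite k E] :
    Submodule.span k (Set.range (detForm (k := k) (E := E) (d := d))) = ⊤ := by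
  rw [eq_top_iff]
  rintro ω -
  let b := Module.finBasis k E
  let L := exteriorPower.alternatingMapLinearEquiv ω
  have h : ω = ∑ s : Set.powersetCard (Fin (Module.finrank k E)) d,
      L (b.exteriorPower d s) •
        detForm fun j => b.coord (Set.powersetCard.ofFinEmbEquiv.symm s j) := by
    ext v
    have h1 : ω v = L (exteriorPower.ιMulti k d v) :=
      (exteriorPower.alternatingMapLinearEquiv_apply_ιMulti ω v).symm
    rw [h1, ← (b.exteriorPower d).sum_repr (exteriorPower.ιMulti k d v), map_sum]
    let ev : (E [⋀^Fin d]→ₗ[k] k) →ₗ[k] k :=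
      { toFun := fun η => η v, map_add' := fun _ _ => rfl, map_smul' := fun _ _ => rfl }
    refine Eq.trans ?_ (map_sum ev _ _).symm
    refine Finset.sum_congr rfl fun s _ => ?_
    rw [map_smul, map_smul, exteriorPower.basis_repr_apply,
      exteriorPower.ιMultiDual_apply_ιMulti, smul_eq_mul, smul_eq_mul, mul_comm]
    rfl
  rw [h]
  exact Submodule.sum_mem _ fun s _ => Submodule.smul_mem _ _ (Submodule.subset_span ⟨_, rfl⟩)

end Decomposable

/-- Two scalar functions of several vectors that are affine in each vector and do not vanish
identically have a common non-zero. -/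
theorem exists_ne_zero_and_ne_zero {k : Type*} [Field k] [Infinite k] {M : Type*} [AddCommGroup M]
    [Module k M] {ι : Type*} [Fintype ι] [DecidableEq ι] (φ ψ : (ι → M) → k)
    (hφ : ∀ c i x y (t : k), φ (Function.update c i (x + t • (y - x))) =
      φ (Function.update c i x) + t * (φ (Function.update c i y) - φ (Function.update c i x)))
    (hψ : ∀ c i x y (t : k), ψ (Function.update c i (x + t • (y - x))) =
      ψ (Function.update c i x) + t * (ψ (Function.update c i y) - ψ (Function.update c i x)))
    (h1 : ∃ a, φ a ≠ 0) (h2 : ∃ b, ψ b ≠ 0) : ∃ c, φ c ≠ 0 ∧ ψ c ≠ 0 := by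
  obtain ⟨a, ha⟩ := h1
  obtain ⟨b, hb⟩ := h2
  -- The vectors of `a` and `b` are replaced one at a time by common ones.
  have key : ∀ s : Finset ι, ∃ c, φ (s.piecewise c a) ≠ 0 ∧ ψ (s.piecewise c b) ≠ 0 := by
    intro s
    induction s using Finset.induction_on with
    | empty => exact ⟨a, by simpa using ha, by simpa using hb⟩
    | insert i s hi ih =>
      obtain ⟨c, hc1, hc2⟩ := ih
      have e1 : s.piecewise c a = Function.update (s.piecewise c a) i (a i) := by
        rw [eq_comm, Function.update_eq_self_iff, Finset.piecewise_eq_of_notMem _ _ _ hi]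
      have e2 : s.piecewise c b = Function.update (s.piecewise c b) i (b i) := by
        rw [eq_comm, Function.update_eq_self_iff, Finset.piecewise_eq_of_notMem _ _ _ hi]
      set p := φ (Function.update (s.piecewise c a) i (a i))
      set q := φ (Function.update (s.piecewise c a) i (b i))
      set p' := ψ (Function.update (s.piecewise c b) i (a i))
      set q' := ψ (Function.update (s.piecewise c b) i (b i))
      have hp : p ≠ 0 := by rw [e1] at hc1; exact hc1
      have hq' : q' ≠ 0 := by rw [e2] at hc2; exact hc2
      classical
      obtain ⟨t, ht⟩ := Infinite.exists_notMem_finset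
        ({-p / (q - p), -p' / (q' - p')} : Finset k)
      simp only [Finset.mem_insert, Finset.mem_singleton, not_or] at ht
      refine ⟨Function.update c i (a i + t • (b i - a i)), ?_, ?_⟩
      · rw [Finset.piecewise_insert, Function.update_self,
          Finset.piecewise_congr s (f' := c) (g' := a) (fun j hj => Function.update_of_ne
            (ne_of_mem_of_not_mem hj hi) _ _) (fun _ _ => rfl), hφ]
        intro h
        by_cases hqp : q - p = 0
        · exact hp (by linear_combination h - t * hqp)
        · exact ht.1 (by rw [eq_div_iff hqp]; linear_combination h)
      · rw [Finset.piecewise_insert, Function.update_self,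
          Finset.piecewise_congr s (f' := c) (g' := b) (fun j hj => Function.update_of_ne
            (ne_of_mem_of_not_mem hj hi) _ _) (fun _ _ => rfl), hψ]
        intro h
        by_cases hqp : q' - p' = 0
        · exact hq' (by linear_combination h + (1 - t) * hqp)
        · exact ht.2 (by rw [eq_div_iff hqp]; linear_combination h)
  obtain ⟨c, hc⟩ := key Finset.univ
  exact ⟨c, by simpa using hc⟩

/-- Decomposable forms `f₁ ∧ ⋯ ∧ f_d` and `f₁ ∧ ⋯ ∧ f_e` attached to the same flag can be chosen
outside given proper subspaces of the spaces of all forms. -/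
theorem exists_detForm_notMem {k : Type*} [Field k] [Infinite k] {E : Type*} [AddCommGroup E]
    [Module k E] [Module.Finite k E] {d e : ℕ} (hde : d ≤ e)
    (N₁ : Submodule k (E [⋀^Fin d]→ₗ[k] k)) (N₂ : Submodule k (E [⋀^Fin e]→ₗ[k] k))
    (h₁ : N₁ ≠ ⊤) (h₂ : N₂ ≠ ⊤) :
    ∃ f : Fin e → Module.Dual k E, detForm (f ∘ Fin.castLE hde) ∉ N₁ ∧ detForm f ∉ N₂ := by
  obtain ⟨l₁, hl₁, hN₁⟩ := Submodule.exists_le_ker_of_lt_top N₁ (lt_top_iff_ne_top.mpr h₁)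
  obtain ⟨l₂, hl₂, hN₂⟩ := Submodule.exists_le_ker_of_lt_top N₂ (lt_top_iff_ne_top.mpr h₂)
  have ex : ∀ {m : ℕ} (l : (E [⋀^Fin m]→ₗ[k] k) →ₗ[k] k), l ≠ 0 →
      ∃ f : Fin m → Module.Dual k E, l (detForm f) ≠ 0 := by
    intro m l hl
    by_contra! h
    refine hl (LinearMap.ext_on_range (v := detForm) span_range_detForm fun f => ?_)
    rw [h f, LinearMap.zero_apply]
  obtain ⟨a, ha⟩ := ex l₁ hl₁
  obtain ⟨f, hf₁, hf₂⟩ := exists_ne_zero_and_ne_zero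
    (fun f : Fin e → Module.Dual k E => l₁ (detForm (f ∘ Fin.castLE hde)))
    (fun f => l₂ (detForm f))
    (fun c i x y t => by
      by_cases hi : ∃ i' : Fin d, Fin.castLE hde i' = i
      · obtain ⟨i', rfl⟩ := hi
        simp only [Function.update_comp_eq_of_injective _ (Fin.castLE_injective hde),
          detForm_update_lineMap, map_add, map_smul, map_sub, smul_eq_mul]
      · simp only [Function.update_comp_eq_of_notMem_range _ _ hi]
        ring)
    (fun c i x y t => by
      simp only [detForm_update_lineMap, map_add, map_smul, map_sub, smul_eq_mul])
    ⟨fun i => if h : (i : ℕ) < d then a ⟨i, h⟩ else 0, by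
      convert ha using 3
      ext i : 1
      simp⟩
    (ex l₂ hl₂)
  exact ⟨f, fun h => hf₁ (hN₁ h), fun h => hf₂ (hN₂ h)⟩

end Plucker

/-! ### Standard affine charts of the Grassmannian -/

namespace Grassmannian

noncomputable section Chart

variable {k : Type u} [Field k] {E : Type u} [AddCommGroup E] [Module k E] {d : ℕ}

/-- The bases `v` of `d`-dimensional subspaces that are dual to the linear forms `f₁, …, f_d`. If
the forms are linearly independent, every complement of `⋂ ker f_i` has exactly one such basis, so
that this is the set of closed points of the standard affine chart of the Grassmannian attached to
`f`; otherwise this type and that chart are both empty. -/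
abbrev Frame (f : Fin d → Module.Dual k E) : Type u :=
  {v : Fin d → E // ∀ i j, f i (v j) = if i = j then 1 else 0}

/-- The coordinate ring of the chart attached to `f`: the functions on `Frame f` that are
polynomials in the coordinates of the basis vectors. -/
abbrev chartRing (f : Fin d → Module.Dual k E) : Subalgebra k (Frame f → k) :=
  Algebra.adjoin k (Set.range fun (p : Module.Dual k E × Fin d) (v : Frame f) => p.1 (v.1 p.2))

/-- The value of functions on the chart at a point. -/
def evalAt (f : Fin d → Module.Dual k E) (v : Frame f) : chartRing f →ₐ[k] k :=
  (Pi.evalAlgHom k (fun _ => k) v).comp (chartRing f).val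

@[simp]
theorem evalAt_apply {f : Fin d → Module.Dual k E} (v : Frame f) (a : chartRing f) :
    evalAt f v a = (a : Frame f → k) v := rfl

theorem coord_mem_chartRing (f : Fin d → Module.Dual k E) (l : Module.Dual k E) (j : Fin d) :
    (fun v : Frame f => l (v.1 j)) ∈ chartRing f :=
  Algebra.subset_adjoin ⟨(l, j), rfl⟩

theorem detForm_frame {f : Fin d → Module.Dual k E} (v : Frame f) : detForm f v.1 = 1 := by
  have h : (Matrix.of fun i j => f j (v.1 i)) = (1 : Matrix (Fin d) (Fin d) k) := by
    ext i j
    simp [v.2, Matrix.one_apply, eq_comm]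
  rw [detForm_apply, h, Matrix.det_one]

theorem detForm_update_frame {f : Fin d → Module.Dual k E} (v : Frame f) (l : Module.Dual k E)
    (j : Fin d) : detForm (Function.update f j l) v.1 = l (v.1 j) := by
  have h : (Matrix.of fun a i => Function.update f j l i (v.1 a)) =
      (1 : Matrix (Fin d) (Fin d) k).updateCol j fun a => l (v.1 a) := by
    ext a i
    by_cases h : i = j
    · subst h; simp
    · simp [h, v.2, Matrix.one_apply, eq_comm]
  rw [detForm_apply, h, ← Matrix.cramer_apply, Matrix.cramer_one]
  rfl

theorem form_mem_chartRing [Module.Finite k E] (f : Fin d → Module.Dual k E)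
    (ω : E [⋀^Fin d]→ₗ[k] k) : (fun v : Frame f => ω v.1) ∈ chartRing f := by
  have h : ω ∈ Submodule.span k (Set.range (detForm (k := k) (E := E) (d := d))) := by
    rw [span_range_detForm]; trivial
  induction h using Submodule.span_induction with
  | mem ω h =>
    obtain ⟨g, rfl⟩ := h
    let M : Matrix (Fin d) (Fin d) (chartRing f) := Matrix.of fun i j =>
      ⟨fun v => g j (v.1 i), coord_mem_chartRing f (g j) i⟩
    have hM : (fun v : Frame f => detForm g v.1) = (M.det : Frame f → k) := by
      funext v
      rw [← evalAt_apply, AlgHom.map_det]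
      rfl
    rw [hM]
    exact M.det.2
  | zero => exact zero_mem _
  | add x y _ _ hx hy => exact add_mem hx hy
  | smul a x _ hx => exact (chartRing f).smul_mem hx a

variable (k E d) in
/-- Restriction of the elements of the Plücker algebra to functions on `Frame f`. -/
def restrict (f : Fin d → Module.Dual k E) : coordRing k E d →ₐ[k] (Frame f → k) :=
  (AlgHom.pi (R := k) fun v : Frame f => Pi.evalAlgHom k (fun _ : Fin d → E => k) v.1).comp
    (coordRing k E d).val

@[simp]
theorem restrict_apply (f : Fin d → Module.Dual k E) (a : coordRing k E d) (v : Frame f) :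
    restrict k E d f a v = (a : (Fin d → E) → k) v.1 := rfl

theorem restrict_mem [Module.Finite k E] (f : Fin d → Module.Dual k E) (a : coordRing k E d) :
    restrict k E d f a ∈ chartRing f := by
  obtain ⟨a, ha⟩ := a
  induction ha using Algebra.adjoin_induction with
  | mem x hx =>
    obtain ⟨ω, rfl⟩ := hx
    exact form_mem_chartRing f ω
  | algebraMap r => exact (chartRing f).algebraMap_mem r
  | add x y hx hy h1 h2 => exact add_mem h1 h2
  | mul x y hx hy h1 h2 => exact mul_mem h1 h2

/-- The Plücker coordinate that is the decomposable form `f₁ ∧ ⋯ ∧ f_d`. -/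
def pluckerCoord (f : Fin d → Module.Dual k E) : coordRing k E d :=
  ⟨formToFun k E d (detForm f), linearForms_le ⟨_, rfl⟩⟩

theorem pluckerCoord_mem (f : Fin d → Module.Dual k E) : pluckerCoord f ∈ grading k E d 1 := by
  rw [mem_grading, pow_one]
  exact ⟨_, rfl⟩

theorem restrict_pluckerCoord (f : Fin d → Module.Dual k E) :
    restrict k E d f (pluckerCoord f) = 1 := by
  ext v
  exact detForm_frame v

/-- A tuple on which `f₁ ∧ ⋯ ∧ f_d` does not vanish can be normalised to a point of the chart with
the same span. -/
theorem exists_frame {f : Fin d → Module.Dual k E} {v : Fin d → E} (h : detForm f v ≠ 0) :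
    ∃ w : Frame f, (∀ j, w.1 j ∈ Submodule.span k (Set.range v)) ∧
      ∀ ω : E [⋀^Fin d]→ₗ[k] k, ω v = detForm f v * ω w.1 := by
  let M : Matrix (Fin d) (Fin d) k := Matrix.of fun i j => f j (v i)
  have hM : IsUnit M.det := isUnit_iff_ne_zero.mpr h
  let w : Fin d → E := fun i => ∑ j, M⁻¹ i j • v j
  have hw : ∀ i j, f i (w j) = if i = j then 1 else 0 := by
    intro i j
    have h1 := congrFun (congrFun (Matrix.nonsing_inv_mul M hM) j) i
    rw [Matrix.mul_apply, Matrix.one_apply] at h1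
    simp only [w, map_sum, map_smul, smul_eq_mul]
    simpa [M, eq_comm] using h1
  have hv : v = fun i => ∑ j, M i j • w j := by
    ext i
    simp only [w, Finset.smul_sum, smul_smul]
    rw [Finset.sum_comm]
    have h1 : ∀ l, ∑ j, (M i j * M⁻¹ j l) • v l = (1 : Matrix (Fin d) (Fin d) k) i l • v l := by
      intro l
      rw [← Finset.sum_smul, ← Matrix.mul_apply, Matrix.mul_nonsing_inv M hM]
    simp [h1, Matrix.one_apply]
  refine ⟨⟨w, hw⟩, fun j => ?_, fun ω => ?_⟩
  · change w j ∈ _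
    exact Submodule.sum_mem _ fun i _ =>
      Submodule.smul_mem _ _ (Submodule.subset_span (Set.mem_range_self i))
  have h2 : ω v = M.det * ω w := by
    let T : (Fin d → k) →ₗ[k] E := Fintype.linearCombination k w
    have hT : (fun i => T (Pi.basisFun k (Fin d) i)) = w := by
      ext i
      simp [T, Fintype.linearCombination_apply, Pi.single_apply]
    have h3 : ω.compLinearMap T (fun i => M i) =
        ω (fun i => T (Pi.basisFun k (Fin d) i)) * (Pi.basisFun k (Fin d)).det fun i => M i :=
      congrArg (fun η : (Fin d → k) [⋀^Fin d]→ₗ[k] k => η fun i => M i)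
        ((ω.compLinearMap T).eq_smul_basis_det (Pi.basisFun k (Fin d)))
    rw [hT, Pi.basisFun_det, mul_comm] at h3
    conv_lhs => rw [hv]
    exact h3
  exact h2

theorem linearIndependent_frame {f : Fin d → Module.Dual k E} (v : Frame f) :
    LinearIndependent k v.1 :=
  LinearIndependent.of_pairwise_dual_eq_zero_one v.1 f (fun i j h => by simp [v.2, h])
    (fun i => by simp [v.2])

theorem finrank_span_frame {f : Fin d → Module.Dual k E} (v : Frame f) :
    Module.finrank k (Submodule.span k (Set.range v.1)) = d := by
  rw [finrank_span_eq_card (linearIndependent_frame v), Fintype.card_fin]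

theorem mul_pluckerCoord_eq_zero {f : Fin d → Module.Dual k E} {m : ℕ} {a : coordRing k E d}
    (ha : a ∈ grading k E d m) (h : restrict k E d f a = 0) : pluckerCoord f * a = 0 := by
  apply Subtype.ext
  funext v
  by_cases hv : detForm f v = 0
  · change detForm f v * _ = 0
    rw [hv, zero_mul]
  · obtain ⟨w, -, hw⟩ := exists_frame hv
    change detForm f v * (a : (Fin d → E) → k) v = 0
    rw [apply_eq_pow_mul hw m (mem_grading.mp ha), ← restrict_apply f a w, h, Pi.zero_apply,
      mul_zero, mul_zero]

variable [Infinite k] [NeZero d]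

/-- At every point of the Grassmannian, closed or not, some Plücker coordinate is non-zero. -/
theorem exists_form_notMem (x : scheme k d E) : ∃ ω : E [⋀^Fin d]→ₗ[k] k,
    (⟨formToFun k E d ω, linearForms_le ⟨ω, rfl⟩⟩ : coordRing k E d) ∉ x.asHomogeneousIdeal := by
  by_contra! h
  apply x.not_irrelevant_le
  have h1 : ∀ m, ∀ a ∈ grading k E d (m + 1), a ∈ x.asHomogeneousIdeal := by
    rintro m ⟨a, ha'⟩ ha
    have ha2 : a ∈ linearForms k E d ^ m * linearForms k E d := by
      rw [← pow_succ]; exact ha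
    induction ha2 using Submodule.mul_induction_on' with
    | mem_mul_mem b hb c hc =>
      obtain ⟨ω, rfl⟩ := hc
      exact Ideal.mul_mem_left x.asHomogeneousIdeal.toIdeal ⟨b, linearForms_pow_le m hb⟩ (h ω)
    | add b hb c hc ihb ihc =>
      rw [← pow_succ] at hb hc
      exact add_mem (ihb (linearForms_pow_le _ hb) hb) (ihc (linearForms_pow_le _ hc) hc)
  intro a ha
  classical
  rw [← DirectSum.sum_support_decompose (grading k E d) a]
  refine sum_mem fun i _ => ?_
  rcases i with _ | i
  · have h0 := (HomogeneousIdeal.mem_irrelevant_iff _ _).mp ha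
    rw [GradedRing.proj_apply] at h0
    rw [h0]
    exact zero_mem _
  · exact h1 i _ (SetLike.coe_mem _)

open HomogeneousLocalization

/-- Evaluation of the degree `0` fractions with denominators `f₁ ∧ ⋯ ∧ f_d` on the chart, where this
form is `1`. -/
def awayToFun (f : Fin d → Module.Dual k E) :
    Away (grading k E d) (pluckerCoord f) →+* (Frame f → k) :=
  (IsLocalization.Away.lift (S := Localization.Away (pluckerCoord f)) (pluckerCoord f)
    (g := (restrict k E d f : coordRing k E d →+* (Frame f → k)))
    (by
      rw [RingHom.coe_coe, restrict_pluckerCoord]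
      exact isUnit_one)).comp (algebraMap _ _)

theorem awayToFun_mk (f : Fin d → Module.Dual k E) (n : ℕ) (a : coordRing k E d)
    (ha : a ∈ grading k E d (n • 1)) :
    awayToFun f (Away.mk (grading k E d) (pluckerCoord_mem f) n a ha) = restrict k E d f a := by
  rw [awayToFun, RingHom.comp_apply, HomogeneousLocalization.algebraMap_apply, Away.val_mk,
    Localization.mk_eq_mk', IsLocalization.Away.lift, IsLocalization.lift_mk'_spec]
  simp [restrict_pluckerCoord]

theorem awayToFun_injective (f : Fin d → Module.Dual k E) :
    Function.Injective (awayToFun f) := by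
  rw [injective_iff_map_eq_zero]
  intro x hx
  obtain ⟨n, a, ha, rfl⟩ := Away.mk_surjective _ (pluckerCoord_mem f) x
  rw [awayToFun_mk] at hx
  apply HomogeneousLocalization.val_injective
  rw [Away.val_mk, HomogeneousLocalization.val_zero, Localization.mk_eq_mk',
    IsLocalization.mk'_eq_zero_iff]
  exact ⟨⟨pluckerCoord f, Submonoid.mem_powers _⟩, mul_pluckerCoord_eq_zero ha hx⟩

theorem range_awayToFun [Module.Finite k E] (f : Fin d → Module.Dual k E) :
    Set.range (awayToFun f) = chartRing f := by
  apply subset_antisymm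
  · rintro _ ⟨x, rfl⟩
    obtain ⟨n, a, ha, rfl⟩ := Away.mk_surjective _ (pluckerCoord_mem f) x
    rw [awayToFun_mk]
    exact restrict_mem f a
  · intro x hx
    have hc : ∀ r : k, algebraMap k (Frame f → k) r ∈ (awayToFun f).rangeS := by
      intro r
      refine ⟨Away.mk _ (pluckerCoord_mem f) 0 (algebraMap k _ r) ?_, ?_⟩
      · rw [zero_smul, mem_grading, pow_zero, Submodule.mem_one]
        exact ⟨r, rfl⟩
      · rw [awayToFun_mk]
        exact (restrict k E d f).commutes r
    have h : x ∈ (awayToFun f).rangeS := by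
      induction hx using Algebra.adjoin_induction with
      | mem x hx =>
        obtain ⟨⟨l, j⟩, rfl⟩ := hx
        refine ⟨Away.mk _ (pluckerCoord_mem f) 1 (pluckerCoord (Function.update f j l)) ?_, ?_⟩
        · rw [one_smul]; exact pluckerCoord_mem _
        · rw [awayToFun_mk]
          ext v
          exact detForm_update_frame v l j
      | algebraMap r => exact hc r
      | add x y hx hy h1 h2 => exact add_mem h1 h2
      | mul x y hx hy h1 h2 => exact mul_mem h1 h2
    exact h

/-- The coordinate ring of the basic open set of the Grassmannian on which `f₁ ∧ ⋯ ∧ f_d` does not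
vanish is the ring of polynomial functions on `Frame f`. -/
def awayEquiv [Module.Finite k E] (f : Fin d → Module.Dual k E) :
    Away (grading k E d) (pluckerCoord f) ≃+* chartRing f :=
  RingEquiv.ofBijective
    ((awayToFun f).codRestrict (chartRing f)
      fun x => by rw [← SetLike.mem_coe, ← range_awayToFun]; exact ⟨x, rfl⟩)
    ⟨fun x y h => awayToFun_injective f (congrArg Subtype.val h), fun y => by
      have hy : (y : Frame f → k) ∈ Set.range (awayToFun f) := by
        rw [range_awayToFun]; exact y.2
      obtain ⟨x, hx⟩ := hy
      exact ⟨x, Subtype.ext hx⟩⟩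

theorem coe_awayEquiv [Module.Finite k E] (f : Fin d → Module.Dual k E)
    (x : Away (grading k E d) (pluckerCoord f)) :
    (awayEquiv f x : Frame f → k) = awayToFun f x := rfl

end Chart

end Grassmannian

/-! ### Algebras of functions on products -/

namespace FunctionAlgebra

noncomputable section

variable {k : Type*} [Field k] {X Y : Type*} {A B : Type*} [CommRing A] [Algebra k A] [CommRing B]
  [Algebra k B]

/-- If `A` and `B` are mapped to algebras of functions, then elements of `A ⊗ B` are mapped to
functions on the product. -/
def tensorToFun (α : A →ₐ[k] (X → k)) (β : B →ₐ[k] (Y → k)) : A ⊗[k] B →ₐ[k] (X × Y → k) :=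
  Algebra.TensorProduct.productMap
    ((AlgHom.pi (R := k) fun z : X × Y => Pi.evalAlgHom k (fun _ => k) z.1).comp α)
    ((AlgHom.pi (R := k) fun z : X × Y => Pi.evalAlgHom k (fun _ => k) z.2).comp β)

variable {α : A →ₐ[k] (X → k)} {β : B →ₐ[k] (Y → k)}

@[simp]
theorem tensorToFun_tmul (a : A) (b : B) (z : X × Y) :
    tensorToFun α β (a ⊗ₜ b) z = α a z.1 * β b z.2 := by
  simp [tensorToFun]

theorem tensorToFun_injective (hα : Function.Injective α) (hβ : Function.Injective β) :
    Function.Injective (tensorToFun α β) := by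
  rw [injective_iff_map_eq_zero]
  intro t ht
  let b := Module.Free.chooseBasis k A
  obtain ⟨c, rfl⟩ := (TensorProduct.equivFinsuppOfBasisLeft (N := B) b).symm.surjective t
  suffices hc : c = 0 by rw [hc, map_zero]
  rw [TensorProduct.equivFinsuppOfBasisLeft_symm_apply] at ht
  ext i
  apply hβ
  rw [Finsupp.zero_apply, map_zero]
  funext y
  -- For fixed `y` the vanishing of the function is a linear relation between the basis elements.
  have h : Finsupp.linearCombination k b (c.mapRange (fun q => β q y) (by simp)) = 0 := by
    refine hα (Eq.trans ?_ (map_zero α).symm)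
    funext x
    have h1 := congrFun ht (x, y)
    rw [Finsupp.sum, map_sum, Finset.sum_apply] at h1
    simp only [tensorToFun_tmul] at h1
    rw [Finsupp.linearCombination_apply, Finsupp.sum_mapRange_index (by simp), Finsupp.sum, map_sum,
      Finset.sum_apply]
    simpa [mul_comm] using h1
  have h2 := DFunLike.congr_fun (b.linearIndependent (h.trans (map_zero _).symm)) i
  simpa using h2

/-- Let `Φ x` be a family of bijections of `Y`, parametrised by `X`, which is polynomial together
with its inverse. If `C` is the algebra of the restrictions of elements of `B` to a subset `F`
of `Y`, then restriction to the subset of all `(x, Φ x y)` with `y ∈ F`, which `Φ` identifies with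
`X × F`, is a surjection from `A ⊗ B` to `A ⊗ C`. -/
theorem exists_trivialization (hα : Function.Injective α) (hβ : Function.Injective β)
    (Φ : X → Y ≃ Y)
    (h : ∀ b, (fun z : X × Y => β b (Φ z.1 z.2)) ∈ (tensorToFun α β).range)
    (h' : ∀ b, (fun z : X × Y => β b ((Φ z.1).symm z.2)) ∈ (tensorToFun α β).range)
    {F : Set Y} {C : Type*} [CommRing C] [Algebra k C] {γ : C →ₐ[k] (F → k)}
    (hγ : Function.Injective γ) {res : B →ₐ[k] C} (hres : Function.Surjective res)
    (hγres : ∀ b y, γ (res b) y = β b y) :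
    ∃ τ : A ⊗[k] B →ₐ[k] A ⊗[k] C, Function.Surjective τ ∧ (∀ a, τ (a ⊗ₜ 1) = a ⊗ₜ 1) ∧
      ∀ t x (y : F), tensorToFun α γ (τ t) (x, y) = tensorToFun α β t (x, Φ x y) := by
  let e : A ⊗[k] B ≃ₐ[k] (tensorToFun α β).range :=
    AlgEquiv.ofInjective _ (tensorToFun_injective hα hβ)
  have he : ∀ t, tensorToFun α β (e.symm t) = t := fun t =>
    congrArg Subtype.val (e.apply_symm_apply t)
  let θ : B →ₐ[k] A ⊗[k] B := e.symm.toAlgHom.comp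
    (((AlgHom.pi (R := k) fun z : X × Y => Pi.evalAlgHom k (fun _ => k) (Φ z.1 z.2)).comp
      β).codRestrict _ h)
  have hθ : ∀ b, tensorToFun α β (θ b) = fun z => β b (Φ z.1 z.2) := fun b => he _
  let ρ : A ⊗[k] B →ₐ[k] A ⊗[k] C := Algebra.TensorProduct.map (AlgHom.id k A) res
  have hρ : ∀ t x (y : F), tensorToFun α γ (ρ t) (x, y) = tensorToFun α β t (x, y) := by
    intro t x y
    induction t using TensorProduct.induction_on with
    | zero => simp only [map_zero, Pi.zero_apply]
    | tmul a b =>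
      rw [Algebra.TensorProduct.map_tmul, tensorToFun_tmul, tensorToFun_tmul, hγres]
      rfl
    | add a b ha hb => simp only [map_add, Pi.add_apply, ha, hb]
  let τ : A ⊗[k] B →ₐ[k] A ⊗[k] C :=
    Algebra.TensorProduct.productMap Algebra.TensorProduct.includeLeft (ρ.comp θ)
  have hτ : ∀ t x (y : F), tensorToFun α γ (τ t) (x, y) = tensorToFun α β t (x, Φ x y) := by
    intro t x y
    induction t using TensorProduct.induction_on with
    | zero => simp only [map_zero, Pi.zero_apply]
    | tmul a b =>
      rw [Algebra.TensorProduct.productMap_apply_tmul, map_mul, Pi.mul_apply, AlgHom.comp_apply,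
        hρ, hθ, Algebra.TensorProduct.includeLeft_apply, tensorToFun_tmul, tensorToFun_tmul,
        map_one, Pi.one_apply, mul_one]
    | add a b ha hb => simp only [map_add, Pi.add_apply, ha, hb]
  have hτl : ∀ a, τ (a ⊗ₜ 1) = a ⊗ₜ 1 := fun a => by
    rw [Algebra.TensorProduct.productMap_apply_tmul, map_one, mul_one]
    rfl
  refine ⟨τ, ?_, hτl, hτ⟩
  intro t
  induction t using TensorProduct.induction_on with
  | zero => exact ⟨0, map_zero _⟩
  | tmul a c =>
    obtain ⟨b, rfl⟩ := hres c
    obtain ⟨s, hs⟩ := h' b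
    refine ⟨a ⊗ₜ 1 * s, tensorToFun_injective hα hγ ?_⟩
    funext ⟨x, y⟩
    have hs' : tensorToFun α β s = fun z : X × Y => β b ((Φ z.1).symm z.2) := hs
    rw [map_mul, hτl, map_mul, Pi.mul_apply, tensorToFun_tmul, tensorToFun_tmul, hτ, hs', map_one,
      Pi.one_apply, mul_one, hγres]
    change _ * β b ((Φ x).symm (Φ x y)) = _ * β b y
    rw [Equiv.symm_apply_apply]
  | add a b ha hb =>
    obtain ⟨a, rfl⟩ := ha
    obtain ⟨b, rfl⟩ := hb
    exact ⟨a + b, map_add _ _ _⟩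

end

end FunctionAlgebra

/-! ### Translations of the charts -/

namespace Grassmannian

noncomputable section Translation

variable {k : Type u} [Field k] {E : Type u} [AddCommGroup E] [Module k E]

section

variable {e : ℕ} {f : Fin e → Module.Dual k E}

/-- The normalised basis of the image of the span of `w` under the endomorphism
`x ↦ x + ∑ i, f i x • c i`. This description is correct if `f i (c j) • c i = 0` for all `i`, `j`;
then that endomorphism preserves the chart, and it is invertible with inverse given by `-c`. -/
def translateFun (c : Fin e → E) (w : Frame f) : Frame f :=
  ⟨fun j => w.1 j + c j - ∑ i, f i (c j) • w.1 i, fun m j => by simp [w.2]⟩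

theorem translateFun_neg {c : Fin e → E} (hc : ∀ i j, f i (c j) • c i = 0) (w : Frame f) :
    translateFun (-c) (translateFun c w) = w := by
  apply Subtype.ext
  funext j
  have h : ∀ i l, f i (c j) * f l (c i) = 0 := fun i l => by
    have := congrArg (f l) (hc i j)
    simpa using this
  simp only [translateFun, Pi.neg_apply, map_neg, neg_smul, Finset.sum_neg_distrib, smul_sub,
    smul_add, Finset.smul_sum, smul_smul, neg_mul, Finset.sum_sub_distrib, Finset.sum_add_distrib,
    hc, h, neg_zero, zero_smul, Finset.sum_const_zero]
  abel

/-- The bijection of the chart induced by the automorphism `x ↦ x + ∑ i, f i x • c i`. -/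
def translate (c : Fin e → E) (hc : ∀ i j, f i (c j) • c i = 0) : Frame f ≃ Frame f where
  toFun := translateFun c
  invFun := translateFun (-c)
  left_inv := translateFun_neg hc
  right_inv w := by
    have := translateFun_neg (c := -c) (fun i j => by simp [hc]) w
    rwa [neg_neg] at this

/-- Translations of the chart preserve the property of meeting a subspace non-trivially, if that
subspace is moved accordingly. -/
theorem inf_ne_bot_translateFun {c : Fin e → E} (hc : ∀ i j, f i (c j) • c i = 0)
    {R R' : Submodule k E} (hR : ∀ x ∈ R, x + ∑ i, f i x • c i ∈ R') (w : Frame f)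
    (h : Submodule.span k (Set.range w.1) ⊓ R ≠ ⊥) :
    Submodule.span k (Set.range (translateFun c w).1) ⊓ R' ≠ ⊥ := by
  obtain ⟨x, ⟨hxw, hxR⟩, hx⟩ := Submodule.exists_mem_ne_zero_of_ne_bot h
  let g : E →ₗ[k] E := LinearMap.id + ∑ i, (f i).smulRight (c i)
  have hg : ∀ x, g x = x + ∑ i, f i x • c i := fun x => by simp [g]
  have hinj : g x ≠ 0 := by
    intro h0
    rw [hg] at h0
    have h1 : ∀ l, f l x • c l = 0 := by
      intro l
      have h2 := congrArg (fun y => f l y • c l) h0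
      simp only [map_add, map_sum, map_smul, smul_eq_mul, add_smul, Finset.sum_smul, mul_smul, hc,
        smul_zero, Finset.sum_const_zero, add_zero, map_zero, zero_smul] at h2
      exact h2
    exact hx (by simpa [h1] using h0)
  have hspan : Submodule.span k (Set.range w.1) ≤
      (Submodule.span k (Set.range (translateFun c w).1)).comap g := by
    rw [Submodule.span_le]
    rintro _ ⟨j, rfl⟩
    have h1 : g (w.1 j) = (translateFun c w).1 j + ∑ i, f i (c j) • (translateFun c w).1 i := by
      have h2 : ∀ i, f i (c j) • (translateFun c w).1 i = f i (c j) • w.1 i := by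
        intro i
        by_cases h0 : f i (c j) = 0
        · rw [h0, zero_smul, zero_smul]
        · have hci : c i = 0 := (smul_eq_zero.mp (hc i j)).resolve_left h0
          simp [translateFun, hci]
      simp only [h2, hg, w.2]
      simp [translateFun]
    rw [SetLike.mem_coe, Submodule.mem_comap, h1]
    exact add_mem (Submodule.subset_span ⟨j, rfl⟩) (Submodule.sum_mem _ fun i _ =>
      Submodule.smul_mem _ _ (Submodule.subset_span ⟨i, rfl⟩))
  exact (Submodule.ne_bot_iff _).mpr ⟨g x, ⟨hspan hxw, hg x ▸ hR x hxR⟩, hinj⟩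

/-- Translations by a polynomially varying `c` are polynomial. -/
theorem comp_translateFun_mem {X : Type*} {P : Subalgebra k (X → k)} (c : X → Fin e → E)
    (hc : ∀ (l : Module.Dual k E) j, (fun x => l (c x j)) ∈ P) (q : Frame f → k)
    (hq : q ∈ chartRing f) :
    (fun z : X × Frame f => q (translateFun (c z.1) z.2)) ∈
      (FunctionAlgebra.tensorToFun P.val (chartRing f).val).range := by
  have hl : ∀ p ∈ P, (fun z : X × Frame f => p z.1) ∈
      (FunctionAlgebra.tensorToFun P.val (chartRing f).val).range := fun p hp =>
    ⟨⟨p, hp⟩ ⊗ₜ 1, by ext z; simp⟩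
  have hr : ∀ q ∈ chartRing f, (fun z : X × Frame f => q z.2) ∈
      (FunctionAlgebra.tensorToFun P.val (chartRing f).val).range := fun q hq =>
    ⟨1 ⊗ₜ ⟨q, hq⟩, by ext z; simp⟩
  induction hq using Algebra.adjoin_induction with
  | mem x hx =>
    obtain ⟨⟨l, j⟩, rfl⟩ := hx
    have h1 : (fun z : X × Frame f => l ((translateFun (c z.1) z.2).1 j)) =
        (fun z => l (z.2.1 j)) + (fun z => l (c z.1 j)) -
          ∑ i, (fun z => f i (c z.1 j)) * fun z => l (z.2.1 i) := by
      ext z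
      simp [translateFun]
    change (fun z : X × Frame f => l ((translateFun (c z.1) z.2).1 j)) ∈ _
    rw [h1]
    exact sub_mem (add_mem (hr _ (coord_mem_chartRing f l j)) (hl _ (hc l j)))
      (sum_mem fun i _ => mul_mem (hl _ (hc _ j)) (hr _ (coord_mem_chartRing f l i)))
  | algebraMap r => exact Subalgebra.algebraMap_mem _ r
  | add x y hx hy h1 h2 => exact add_mem h1 h2
  | mul x y hx hy h1 h2 => exact mul_mem h1 h2

end

section

variable {d e : ℕ} (hde : d ≤ e) {f : Fin e → Module.Dual k E}

/-- The differences of two frames of the chart attached to `f₁, …, f_d`, continued by `0`. -/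
def shift (v v' : Frame (f ∘ Fin.castLE hde)) (j : Fin e) : E :=
  if h : (j : ℕ) < d then v'.1 ⟨j, h⟩ - v.1 ⟨j, h⟩ else 0

theorem shift_castLE (v v' : Frame (f ∘ Fin.castLE hde)) (j : Fin d) :
    shift hde v v' (Fin.castLE hde j) = v'.1 j - v.1 j := by
  simp [shift]

theorem shift_smul_shift (v v' : Frame (f ∘ Fin.castLE hde)) (i j : Fin e) :
    f i (shift hde v v' j) • shift hde v v' i = 0 := by
  by_cases hi : (i : ℕ) < d
  · suffices h : f i (shift hde v v' j) = 0 by rw [h, zero_smul]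
    by_cases hj : (j : ℕ) < d
    · have h := v.2 ⟨i, hi⟩ ⟨j, hj⟩
      have h' := v'.2 ⟨i, hi⟩ ⟨j, hj⟩
      simp only [Function.comp_apply, Fin.castLE_mk, Fin.eta] at h h'
      rw [shift, dif_pos hj, map_sub, h, h', sub_self]
    · rw [shift, dif_neg hj, map_zero]
  · rw [shift.eq_1 hde v v' i, dif_neg hi, smul_zero]

theorem neg_shift (v v' : Frame (f ∘ Fin.castLE hde)) : -shift hde v v' = shift hde v' v := by
  ext j
  by_cases hj : (j : ℕ) < d <;> simp [shift, hj]

/-- The automorphism attached to `shift v v'` maps the span of `v` to the span of `v'`. -/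
theorem add_sum_shift_mem (v v' : Frame (f ∘ Fin.castLE hde)) (x : E)
    (hx : x ∈ Submodule.span k (Set.range v.1)) :
    x + ∑ i, f i x • shift hde v v' i ∈ Submodule.span k (Set.range v'.1) := by
  induction hx using Submodule.span_induction with
  | mem x hx =>
    obtain ⟨j, rfl⟩ := hx
    have h : ∑ i, f i (v.1 j) • shift hde v v' i = v'.1 j - v.1 j := by
      rw [Finset.sum_eq_single (Fin.castLE hde j), shift_castLE]
      · have := v.2 j j
        simp only [Function.comp_apply, if_true] at this
        rw [this, one_smul]
      · intro i _ hij
        by_cases hi : (i : ℕ) < d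
        · have := v.2 ⟨i, hi⟩ j
          rw [if_neg (fun h => hij (by rw [← h]; rfl))] at this
          simp only [Function.comp_apply, Fin.castLE_mk, Fin.eta] at this
          rw [this, zero_smul]
        · rw [shift, dif_neg hi, smul_zero]
      · simp
    rw [h, add_sub_cancel]
    exact Submodule.subset_span ⟨j, rfl⟩
  | zero => simp
  | add x y _ _ hx hy =>
    have h := add_mem hx hy
    simp only [map_add, add_smul, Finset.sum_add_distrib]
    convert h using 1
    abel
  | smul a x _ hx =>
    have h := Submodule.smul_mem _ a hx
    simpa only [map_smul, smul_eq_mul, mul_smul, smul_add, Finset.smul_sum] using h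

theorem shift_coord_mem (v₀ : Frame (f ∘ Fin.castLE hde)) (l : Module.Dual k E) (j : Fin e) :
    (fun v => l (shift hde v₀ v j)) ∈ chartRing (f ∘ Fin.castLE hde) := by
  by_cases hj : (j : ℕ) < d
  · simp only [shift, dif_pos hj, map_sub]
    exact sub_mem (coord_mem_chartRing _ l _) (Subalgebra.algebraMap_mem _ (l (v₀.1 ⟨j, hj⟩)))
  · simp only [shift, dif_neg hj, map_zero]
    exact zero_mem _

/-- The automorphism of the chart attached to `f₁, …, f_e` induced by an automorphism of the vector
space that maps the span of `v` to the span of `v'`. -/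
def transport (v v' : Frame (f ∘ Fin.castLE hde)) : Frame f ≃ Frame f :=
  translate (shift hde v v') (shift_smul_shift hde v v')

open FunctionAlgebra in
theorem comp_transport_mem (v₀ : Frame (f ∘ Fin.castLE hde)) (q : chartRing f) :
    (fun z : Frame (f ∘ Fin.castLE hde) × Frame f =>
        (chartRing f).val q (transport hde v₀ z.1 z.2)) ∈
      (tensorToFun (chartRing (f ∘ Fin.castLE hde)).val (chartRing f).val).range :=
  comp_translateFun_mem (f := f) (shift hde v₀) (shift_coord_mem hde v₀) (q : Frame f → k) q.2

open FunctionAlgebra in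
theorem comp_transport_symm_mem (v₀ : Frame (f ∘ Fin.castLE hde)) (q : chartRing f) :
    (fun z : Frame (f ∘ Fin.castLE hde) × Frame f =>
        (chartRing f).val q ((transport hde v₀ z.1).symm z.2)) ∈
      (tensorToFun (chartRing (f ∘ Fin.castLE hde)).val (chartRing f).val).range :=
  have h : ∀ (l : Module.Dual k E) (j : Fin e),
      (fun v => l ((-shift hde v₀ v) j)) ∈ chartRing (f ∘ Fin.castLE hde) := fun l j => by
    simp only [Pi.neg_apply, map_neg]
    exact neg_mem (shift_coord_mem hde v₀ l j)
  comp_translateFun_mem (f := f) (fun v => -shift hde v₀ v) h (q : Frame f → k) q.2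

/-- The pairs of frames whose spans meet non-trivially. -/
def incident (f : Fin e → Module.Dual k E) : Set (Frame (f ∘ Fin.castLE hde) × Frame f) :=
  {z | Submodule.span k (Set.range z.2.1) ⊓ Submodule.span k (Set.range z.1.1) ≠ ⊥}

theorem transport_mem_incident {v v' : Frame (f ∘ Fin.castLE hde)} {w : Frame f} :
    (v', transport hde v v' w) ∈ incident hde f ↔
      (v, w) ∈ incident hde f := by
  constructor
  · intro h
    have h1 := inf_ne_bot_translateFun (shift_smul_shift hde v' v) (add_sum_shift_mem hde v' v) _ h
    rw [← neg_shift] at h1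
    have h2 : translateFun (-shift hde v v') (transport hde v v' w) = w :=
      (transport hde v v').symm_apply_apply w
    change Submodule.span k (Set.range
      (translateFun (-shift hde v v') (transport hde v v' w)).1) ⊓ _ ≠ _ at h1
    rw [h2] at h1
    exact h1
  · exact inf_ne_bot_translateFun (shift_smul_shift hde v v') (add_sum_shift_mem hde v v') w

theorem transport_symm_mem_incident {v v' : Frame (f ∘ Fin.castLE hde)} {w : Frame f} :
    (v, (transport hde v v').symm w) ∈ incident hde f ↔ (v', w) ∈ incident hde f := by
  rw [← transport_mem_incident hde (v' := v'), Equiv.apply_symm_apply]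

end

end Translation

end Grassmannian

/-! ### Reduced closed subschemes -/

namespace ReducedSubscheme

open Scheme Scheme.IdealSheafData TopologicalSpace

/-- The formation of the reduced structure on a closed subset is local. -/
theorem vanishingIdeal_comap {X Y : Scheme.{u}} (Z : Closeds X) (j : Y ⟶ X) [IsOpenImmersion j] :
    (vanishingIdeal Z).comap j = vanishingIdeal (Z.preimage j.continuous) := by
  have h1 : ((vanishingIdeal Z).comap j).radical = (vanishingIdeal Z).comap j := by
    ext U : 2
    rw [radical_ideal, ideal_comap_of_isOpenImmersion, ← Ideal.comap_radical]
    congr 1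
    exact (PrimeSpectrum.isRadical_vanishingIdeal _).radical
  have h2 : ((vanishingIdeal Z).comap j).support = Z.preimage j.continuous := by
    rw [support_comap]
    congr 1
  rw [← h1, ← vanishingIdeal_support, h2]

theorem ker_eq_vanishingIdeal {X Y : Scheme.{u}} [IsReduced X] (f : X ⟶ Y) :
    f.ker = vanishingIdeal (Closeds.closure (Set.range f)) := by
  rw [← map_bot, ← Scheme.nilradical_eq_bot, ← vanishingIdeal_top, map_vanishingIdeal]
  congr 2
  exact Set.image_univ

/-- The reduced subscheme on the closure of a set `T` restricts, over an open subscheme `Y`, to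
any reduced closed subscheme of `Y` in which the points of `T` are dense. -/
theorem exists_isPullback {X Y Z : Scheme.{u}} (T : Set X) (j : Y ⟶ X) [IsOpenImmersion j]
    (i : Z ⟶ Y) [IsClosedImmersion i] [IsReduced Z] (D : Set Z) (hD : Dense D)
    (h : j ⁻¹' T = i '' D) :
    ∃ φ : Z ⟶ (vanishingIdeal (Closeds.closure T)).subscheme,
      IsPullback i φ j (vanishingIdeal (Closeds.closure T)).subschemeι := by
  have h1 : (vanishingIdeal (Closeds.closure T)).comap j = i.ker := by
    rw [vanishingIdeal_comap, ker_eq_vanishingIdeal]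
    congr 1
    apply SetLike.coe_injective
    change j ⁻¹' (closure T) = closure (Set.range i)
    rw [j.isOpenEmbedding.isOpenMap.preimage_closure_eq_closure_preimage j.continuous, h,
      ← Set.image_univ, ← hD.closure_eq, closure_image_closure i.continuous]
  have h2 : (vanishingIdeal (Closeds.closure T)).subschemeι.ker ≤ (i ≫ j).ker := by
    rw [ker_subschemeι, Scheme.Hom.ker_comp, le_map_iff_comap_le, h1]
  exact ⟨IsClosedImmersion.lift _ _ h2, isPullback_of_isClosedImmersion _ _ _ _
    (IsClosedImmersion.lift_fac _ _ h2).symm (by rw [ker_subschemeι, h1])⟩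

end ReducedSubscheme

/-! ### Standard affine charts as open subschemes -/

namespace Grassmannian

noncomputable section ChartMap

variable {k : Type u} [Field k] [Infinite k] {E : Type u} [AddCommGroup E] [Module k E]
  [Module.Finite k E] {d : ℕ} [NeZero d]

/-- The chart of the Grassmannian attached to `f`, as an open immersion. -/
def chartι (f : Fin d → Module.Dual k E) : Spec (.of (chartRing f)) ⟶ scheme k d E :=
  Spec.map (awayEquiv f).toCommRingCatIso.hom ≫
    Proj.awayι (grading k E d) (pluckerCoord f) (pluckerCoord_mem f) one_pos

instance (f : Fin d → Module.Dual k E) : IsOpenImmersion (chartι f) := by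
  unfold chartι
  infer_instance

theorem chartι_toSpec (f : Fin d → Module.Dual k E) :
    chartι f ≫ toSpec k d E = Spec.map (CommRingCat.ofHom (algebraMap k (chartRing f))) := by
  rw [chartι, toSpec, Category.assoc, Proj.awayι_toSpecZero_assoc, ← Spec.map_comp,
    ← Spec.map_comp]
  congr 1
  refine CommRingCat.hom_ext (RingHom.ext fun r => Subtype.ext ?_)
  have h : HomogeneousLocalization.fromZeroRingHom (grading k E d)
      (Submonoid.powers (pluckerCoord f)) (algebraMap k _ r) =
      HomogeneousLocalization.Away.mk (grading k E d) (pluckerCoord_mem f) 0 (algebraMap k _ r)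
        (by rw [zero_smul]; exact (algebraMap k (grading k E d 0) r).2) := by
    apply HomogeneousLocalization.val_injective
    rw [HomogeneousLocalization.Away.val_mk]
    simp [HomogeneousLocalization.fromZeroRingHom]
    rfl
  change (awayEquiv f (HomogeneousLocalization.fromZeroRingHom (grading k E d)
      (Submonoid.powers (pluckerCoord f)) (algebraMap k _ r)) : Frame f → k) = _
  rw [coe_awayEquiv, h, awayToFun_mk]
  exact (restrict k E d f).commutes r

theorem mem_range_chartι (f : Fin d → Module.Dual k E) (x : scheme k d E) :
    x ∈ Set.range (chartι f) ↔ pluckerCoord f ∉ x.asHomogeneousIdeal := by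
  have h : (chartι f).opensRange = Proj.basicOpen (grading k E d) (pluckerCoord f) :=
    (Scheme.Hom.opensRange_comp_of_isIso _ _).trans (Proj.opensRange_awayι _ _ _ _)
  rw [← Proj.mem_basicOpen, ← h]
  rfl

theorem nonempty_frame_of_mem_range {f : Fin d → Module.Dual k E} {x : scheme k d E}
    (hx : x ∈ Set.range (chartι f)) : Nonempty (Frame f) := by
  by_contra! h
  refine (mem_range_chartι _ _).mp hx ?_
  have h0 : pluckerCoord f = 0 := by
    apply Subtype.ext
    funext v
    by_contra hv
    obtain ⟨w, -⟩ := exists_frame hv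
    exact h.elim w
  rw [h0]
  exact zero_mem _

/-- A point of the chart lies on the hypersurface defined by a homogeneous element of the Plücker
algebra if and only if the restriction of this element lies in the corresponding prime ideal. -/
theorem mem_chartι_apply (f : Fin d → Module.Dual k E) (y : Spec (.of (chartRing f))) {m : ℕ}
    {a : coordRing k E d} (ha : a ∈ grading k E d m) :
    a ∈ (chartι f y).asHomogeneousIdeal ↔
      (⟨restrict k E d f a, restrict_mem f a⟩ : chartRing f) ∈ y.asIdeal := by
  have key : ∀ {m : ℕ} {a : coordRing k E d} (_ : a ∈ grading k E d m) (_ : 0 < m),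
      a ∈ (chartι f y).asHomogeneousIdeal ↔
        (⟨restrict k E d f a, restrict_mem f a⟩ : chartRing f) ∈ y.asIdeal := by
    intro m a ha hm
    have h1 := Proj.awayι_preimage_basicOpen (grading k E d) (pluckerCoord_mem f) one_pos ha hm
    have h2 := congrArg (fun U : TopologicalSpace.Opens _ =>
      Spec.map (awayEquiv f).toCommRingCatIso.hom y ∈ U) h1
    simp only [eq_iff_iff] at h2
    have h3 := not_congr h2
    change ¬ ¬ _ ↔ ¬ ¬ _ at h3
    rw [not_not, not_not] at h3
    refine h3.trans ?_
    change awayEquiv f _ ∈ y.asIdeal ↔ _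
    have h4 : awayEquiv f (HomogeneousLocalization.Away.isLocalizationElem (pluckerCoord_mem f) ha)
        = ⟨restrict k E d f a, restrict_mem f a⟩ := by
      apply Subtype.ext
      rw [coe_awayEquiv, HomogeneousLocalization.Away.isLocalizationElem, awayToFun_mk, pow_one]
    rw [h4]
  have h0 : pluckerCoord f ∉ (chartι f y).asHomogeneousIdeal :=
    (mem_range_chartι f _).mp ⟨y, rfl⟩
  have h5 := key (SetLike.mul_mem_graded ha (pluckerCoord_mem f)) m.succ_pos
  have h6 : (⟨restrict k E d f (a * pluckerCoord f), restrict_mem f _⟩ : chartRing f) =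
      ⟨restrict k E d f a, restrict_mem f a⟩ := by
    apply Subtype.ext
    change restrict k E d f (a * pluckerCoord f) = _
    rw [map_mul, restrict_pluckerCoord, mul_one]
  rw [h6] at h5
  rw [← h5]
  exact ⟨fun h => Ideal.mul_mem_right _ _ h, fun h =>
    ((chartι f y).isPrime.mem_or_mem h).resolve_right h0⟩

/-- The closed point of the chart given by a frame. -/
def framePoint {f : Fin d → Module.Dual k E} (v : Frame f) : Spec (.of (chartRing f)) :=
  ⟨RingHom.ker (evalAt f v), RingHom.ker_isPrime _⟩

theorem chartι_framePoint {f : Fin d → Module.Dual k E} (v : Frame f) :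
    chartι f (framePoint v) =
      point (Submodule.span k (Set.range v.1)) (finrank_span_frame v) := by
  refine ProjectiveSpectrum.ext (HomogeneousIdeal.ext' fun i a ha => ?_)
  rw [mem_chartι_apply f _ ha]
  change (a : (Fin d → E) → k) v.1 = 0 ↔ a ∈ ideal d _
  constructor
  · intro h
    let e := Module.Basis.span (linearIndependent_frame v)
    refine mem_ideal_of_basis e ha ?_
    convert h
    exact congrArg Subtype.val (Module.Basis.span_apply (linearIndependent_frame v) _)
  · exact fun h => h v.1 fun i => Submodule.subset_span ⟨i, rfl⟩

/-- The closed points of the chart are given by frames. -/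
theorem exists_frame_of_chartι_eq_point {f : Fin d → Module.Dual k E}
    {y : Spec (.of (chartRing f))} {W : Submodule k E} (hW : Module.finrank k W = d)
    (h : chartι f y = point W hW) :
    ∃ v : Frame f, y = framePoint v ∧ W = Submodule.span k (Set.range v.1) := by
  have h1 : pluckerCoord f ∉ (point W hW).asHomogeneousIdeal := by
    rw [← h, ← mem_range_chartι]
    exact ⟨y, rfl⟩
  have h2 : ∃ w : Fin d → E, (∀ i, w i ∈ W) ∧ detForm f w ≠ 0 := by
    by_contra! h3
    exact h1 h3
  obtain ⟨w, hw, hfw⟩ := h2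
  obtain ⟨v, hv, -⟩ := exists_frame hfw
  have h3 : W = Submodule.span k (Set.range v.1) := by
    symm
    refine Submodule.eq_of_le_of_finrank_eq ?_ (by rw [finrank_span_frame, hW])
    rw [Submodule.span_le]
    rintro _ ⟨j, rfl⟩
    exact (Submodule.span_le.mpr (by rintro _ ⟨i, rfl⟩; exact hw i)) (hv j)
  refine ⟨v, (chartι f).isOpenEmbedding.injective ?_, h3⟩
  subst h3
  rw [h, chartι_framePoint]

/-- Charts attached to the same flag of linear forms can be found around given points of two
Grassmannians. -/
theorem exists_mem_range_chartι {e : ℕ} [NeZero e] (hde : d ≤ e) (x : scheme k d E)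
    (y : scheme k e E) : ∃ f : Fin e → Module.Dual k E,
      x ∈ Set.range (chartι (f ∘ Fin.castLE hde)) ∧ y ∈ Set.range (chartι f) := by
  have N : ∀ {m : ℕ} [NeZero m] (x : scheme k m E), ∃ N : Submodule k (E [⋀^Fin m]→ₗ[k] k),
      N ≠ ⊤ ∧ ∀ g : Fin m → Module.Dual k E, detForm g ∉ N →
        pluckerCoord g ∉ x.asHomogeneousIdeal := by
    intro m _ x
    let F : (E [⋀^Fin m]→ₗ[k] k) →ₗ[k] coordRing k E m :=
      (formToFun k E m).codRestrict (Subalgebra.toSubmodule (coordRing k E m))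
        fun ω => linearForms_le ⟨ω, rfl⟩
    refine ⟨(x.asHomogeneousIdeal.toIdeal.restrictScalars k).comap F, ?_, fun g hg h => hg h⟩
    intro h
    obtain ⟨ω, hω⟩ := exists_form_notMem x
    have h1 : ω ∈ (⊤ : Submodule k (E [⋀^Fin m]→ₗ[k] k)) := trivial
    rw [← h] at h1
    exact hω h1
  obtain ⟨N₁, h₁, h₁'⟩ := N x
  obtain ⟨N₂, h₂, h₂'⟩ := N y
  obtain ⟨f, hf₁, hf₂⟩ := exists_detForm_notMem hde N₁ N₂ h₁ h₂
  exact ⟨f, (mem_range_chartι _ _).mpr (h₁' _ hf₁), (mem_range_chartι _ _).mpr (h₂' _ hf₂)⟩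

end ChartMap

end Grassmannian

/-! ### Points of algebras of functions -/

namespace FunctionAlgebra

section Points

variable {k : Type*} [Field k] {X Y : Type*} {A B C : Type*} [CommRing A] [Algebra k A]
  [CommRing B] [Algebra k B] [CommRing C] [Algebra k C]

/-- The prime ideal of the elements of an algebra of functions on `X` that vanish at `x`. -/
def evalPoint (α : A →ₐ[k] (X → k)) (x : X) : PrimeSpectrum A :=
  ⟨RingHom.ker ((Pi.evalAlgHom k (fun _ => k) x).comp α), RingHom.ker_isPrime _⟩

theorem mem_evalPoint {α : A →ₐ[k] (X → k)} {x : X} {a : A} :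
    a ∈ (evalPoint α x).asIdeal ↔ α a x = 0 := Iff.rfl

theorem isReduced_of_injective {α : A →ₐ[k] (X → k)} (hα : Function.Injective α) :
    IsReduced A :=
  _root_.isReduced_of_injective α hα

theorem dense_range_evalPoint {α : A →ₐ[k] (X → k)} (hα : Function.Injective α) :
    Dense (Set.range (evalPoint α)) := by
  have h : PrimeSpectrum.vanishingIdeal (Set.range (evalPoint α)) = ⊥ := by
    rw [eq_bot_iff]
    intro a ha
    rw [PrimeSpectrum.mem_vanishingIdeal] at ha
    rw [Ideal.mem_bot]
    refine hα (Eq.trans ?_ (map_zero α).symm)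
    funext x
    exact mem_evalPoint.mp (ha _ ⟨x, rfl⟩)
  rw [dense_iff_closure_eq, ← PrimeSpectrum.zeroLocus_vanishingIdeal_eq_closure, h]
  exact PrimeSpectrum.zeroLocus_bot

theorem comap_evalPoint {α : A →ₐ[k] (X → k)} {β : B →ₐ[k] (Y → k)} (g : A →+* B) {x : X} {y : Y}
    (h : ∀ a, β (g a) y = α a x) :
    PrimeSpectrum.comap g (evalPoint β y) = evalPoint α x :=
  PrimeSpectrum.ext (Ideal.ext fun a => by
    change β (g a) y = 0 ↔ α a x = 0
    rw [h])

variable {α : A →ₐ[k] (X → k)} {β : B →ₐ[k] (Y → k)}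

theorem comap_includeLeft_evalPoint (z : X × Y) :
    PrimeSpectrum.comap Algebra.TensorProduct.includeLeftRingHom
      (evalPoint (tensorToFun α β) z) = evalPoint α z.1 :=
  comap_evalPoint _ fun a => by
    rw [Algebra.TensorProduct.includeLeftRingHom_apply, tensorToFun_tmul, map_one, Pi.one_apply,
      mul_one]

theorem comap_includeRight_evalPoint (z : X × Y) :
    PrimeSpectrum.comap (Algebra.TensorProduct.includeRight : B →ₐ[k] A ⊗[k] B).toRingHom
      (evalPoint (tensorToFun α β) z) = evalPoint β z.2 :=
  comap_evalPoint _ fun b => by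
    change tensorToFun α β (1 ⊗ₜ b) z = _
    rw [tensorToFun_tmul, map_one, Pi.one_apply, one_mul]

/-- A point of the spectrum of `A ⊗ B` lying over the rational points `x` and `y` is the rational
point `(x, y)`. -/
theorem eq_evalPoint_of_comap_eq {p : PrimeSpectrum (A ⊗[k] B)} {x : X} {y : Y}
    (hx : PrimeSpectrum.comap Algebra.TensorProduct.includeLeftRingHom p = evalPoint α x)
    (hy : PrimeSpectrum.comap (Algebra.TensorProduct.includeRight : B →ₐ[k] A ⊗[k] B).toRingHom p =
      evalPoint β y) : p = evalPoint (tensorToFun α β) (x, y) := by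
  have hA : ∀ a, α a x = 0 → a ⊗ₜ 1 ∈ p.asIdeal := fun a ha => by
    have h : a ∈ (evalPoint α x).asIdeal := ha
    rw [← hx] at h
    exact h
  have hB : ∀ b, β b y = 0 → 1 ⊗ₜ b ∈ p.asIdeal := fun b hb => by
    have h : b ∈ (evalPoint β y).asIdeal := hb
    rw [← hy] at h
    exact h
  have key : ∀ t, t - algebraMap k _ (tensorToFun α β t (x, y)) ∈ p.asIdeal := by
    intro t
    induction t using TensorProduct.induction_on with
    | zero => simp
    | tmul a b =>
      have h1 := Ideal.mul_mem_left p.asIdeal (1 ⊗ₜ b) (hA (a - algebraMap k A (α a x)) (by simp))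
      have h2 := Ideal.mul_mem_left p.asIdeal (algebraMap k _ (α a x))
        (hB (b - algebraMap k B (β b y)) (by simp))
      convert add_mem h1 h2 using 1
      rw [tensorToFun_tmul, TensorProduct.sub_tmul, TensorProduct.tmul_sub, mul_sub, mul_sub,
        Algebra.TensorProduct.tmul_mul_tmul, Algebra.TensorProduct.tmul_mul_tmul, one_mul, one_mul,
        mul_one, map_mul, Algebra.TensorProduct.algebraMap_apply,
        Algebra.TensorProduct.algebraMap_apply, Algebra.TensorProduct.tmul_mul_tmul,
        Algebra.TensorProduct.tmul_mul_tmul, Algebra.TensorProduct.tmul_mul_tmul]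
      simp [Algebra.algebraMap_eq_smul_one, TensorProduct.smul_tmul', TensorProduct.tmul_smul]
    | add s t hs ht =>
      rw [map_add, Pi.add_apply, map_add, add_sub_add_comm]
      exact add_mem hs ht
  have hle : (evalPoint (tensorToFun α β) (x, y)).asIdeal ≤ p.asIdeal := by
    intro t ht
    have h := key t
    rwa [mem_evalPoint.mp ht, map_zero, sub_zero] at h
  have hmax : (evalPoint (tensorToFun α β) (x, y)).asIdeal.IsMaximal :=
    RingHom.ker_isMaximal_of_surjective
      (((Pi.evalAlgHom k (fun _ => k) (x, y)).comp (tensorToFun α β)) : A ⊗[k] B →+* k)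
      fun r => ⟨algebraMap k _ r,
        AlgHom.commutes ((Pi.evalAlgHom k (fun _ => k) (x, y)).comp (tensorToFun α β)) r⟩
  exact PrimeSpectrum.ext (hmax.eq_of_le p.isPrime.ne_top hle).symm

end Points

end FunctionAlgebra

/-! ### A criterion for flatness -/

namespace ReducedSubscheme

open FunctionAlgebra Scheme.IdealSheafData TopologicalSpace

/-- Let `T` be a set of points of `S`. If in an open subscheme `Spec (A ⊗ B)` these are the rational
points `(x, Φ x y)` with `y` in a fixed set `F`, where the bijections `Φ x` vary polynomially with
the rational point `x` of `Spec A`, then the reduced closure of `T` is a product of `Spec A` with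
another scheme there, and therefore flat over `Spec A`. -/
theorem exists_flat_chart {k : Type u} [Field k] {X Y : Type u} {A B : Type u} [CommRing A]
    [Algebra k A] [CommRing B] [Algebra k B] {α : A →ₐ[k] (X → k)} {β : B →ₐ[k] (Y → k)}
    (hα : Function.Injective α) (hβ : Function.Injective β) (Φ : X → Y ≃ Y)
    (h : ∀ b, (fun z : X × Y => β b (Φ z.1 z.2)) ∈ (tensorToFun α β).range)
    (h' : ∀ b, (fun z : X × Y => β b ((Φ z.1).symm z.2)) ∈ (tensorToFun α β).range) (F : Set Y)
    {S G : Scheme.{u}} (T : Set S) (g : S ⟶ G) (c : Spec (.of A) ⟶ G) [IsOpenImmersion c]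
    (j : Spec (.of (A ⊗[k] B)) ⟶ S) [IsOpenImmersion j]
    (hj : j ≫ g = Spec.map (CommRingCat.ofHom Algebra.TensorProduct.includeLeftRingHom) ≫ c)
    (hT : j ⁻¹' T = evalPoint (tensorToFun α β) '' {z | (Φ z.1).symm z.2 ∈ F})
    (s : (vanishingIdeal (Closeds.closure T)).subscheme)
    (hs : (vanishingIdeal (Closeds.closure T)).subschemeι s ∈ Set.range j) :
    ∃ (Z : Scheme.{u}) (φ : Z ⟶ (vanishingIdeal (Closeds.closure T)).subscheme),
      IsOpenImmersion φ ∧ s ∈ Set.range φ ∧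
        Flat (φ ≫ (vanishingIdeal (Closeds.closure T)).subschemeι ≫ g) := by
  let r : B →ₐ[k] (F → k) :=
    (AlgHom.pi (R := k) fun y : F => Pi.evalAlgHom k (fun _ => k) y.1).comp β
  have hγ : Function.Injective r.range.val := Subtype.val_injective
  obtain ⟨τ, hτ, hτl, hτe⟩ := exists_trivialization hα hβ Φ h h' hγ
    (res := r.rangeRestrict) r.rangeRestrict_surjective (fun b y => rfl)
  have hinj : Function.Injective (tensorToFun α r.range.val) := tensorToFun_injective hα hγ
  have hred : _root_.IsReduced (A ⊗[k] r.range) := FunctionAlgebra.isReduced_of_injective hinj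
  let i : Spec (.of (A ⊗[k] r.range)) ⟶ Spec (.of (A ⊗[k] B)) :=
    Spec.map (CommRingCat.ofHom τ.toRingHom)
  have : IsClosedImmersion i := IsClosedImmersion.spec_of_surjective _ hτ
  have hi : ∀ z : X × F, i (evalPoint (tensorToFun α r.range.val) z) =
      evalPoint (tensorToFun α β) (z.1, Φ z.1 z.2) := fun z =>
    comap_evalPoint τ.toRingHom fun t => hτe t z.1 z.2
  have hpre : j ⁻¹' T = i '' Set.range (evalPoint (tensorToFun α r.range.val)) := by
    refine hT.trans (Set.ext fun p => ⟨?_, ?_⟩)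
    · rintro ⟨⟨x, y⟩, hy, rfl⟩
      refine ⟨_, ⟨(x, ⟨(Φ x).symm y, hy⟩), rfl⟩, ?_⟩
      rw [hi, Equiv.apply_symm_apply]
    · rintro ⟨_, ⟨⟨x, y⟩, rfl⟩, rfl⟩
      refine ⟨(x, Φ x y), ?_, (hi (x, y)).symm⟩
      rw [Set.mem_ofPred_eq, Equiv.symm_apply_apply]
      exact y.2
  obtain ⟨φ, hφ⟩ := exists_isPullback T j i _ (dense_range_evalPoint hinj) hpre
  refine ⟨_, φ, MorphismProperty.of_isPullback hφ inferInstance, ?_, ?_⟩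
  · obtain ⟨y, hy⟩ := hs
    obtain ⟨z, -, hz⟩ := Scheme.exists_preimage_of_isPullback hφ y s hy
    exact ⟨z, hz⟩
  · have h1 : φ ≫ (vanishingIdeal (Closeds.closure T)).subschemeι ≫ g =
        Spec.map (CommRingCat.ofHom (algebraMap A (A ⊗[k] r.range))) ≫ c := by
      rw [← Category.assoc, ← hφ.w, Category.assoc, hj, ← Category.assoc, ← Spec.map_comp]
      congr 2
      exact CommRingCat.hom_ext (RingHom.ext hτl)
    have h2 : Flat (Spec.map (CommRingCat.ofHom (algebraMap A (A ⊗[k] r.range)))) := by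
      rw [Flat.SpecMap_iff]
      exact RingHom.flat_algebraMap_iff.mpr inferInstance
    rw [h1]
    infer_instance

end ReducedSubscheme

/-! ### Flatness of the incidence variety -/

namespace Incidence

noncomputable section Charts

open Grassmannian FunctionAlgebra

variable {k : Type u} [Field k] [IsAlgClosed k] {V : Type u} [AddCommGroup V] [Module k V]
  [Module.Finite k V] (f : Fin 8 → Module.Dual k (V ⊗[k] V))

theorem six_le_eight : 6 ≤ 8 := by norm_num

/-- The first `6` of the linear forms. -/
abbrev initial : Fin 6 → Module.Dual k (V ⊗[k] V) := f ∘ Fin.castLE six_le_eight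

/-- The product of the charts of the two Grassmannians attached to `f`, as an open subscheme of the
product of the Grassmannians. -/
def chartι : Spec (.of (chartRing (initial f) ⊗[k] chartRing f)) ⟶ ambient k V :=
  (pullbackSpecIso k (chartRing (initial f)) (chartRing f)).inv ≫
    pullback.map _ _ _ _ (Grassmannian.chartι (initial f)) (Grassmannian.chartι f) (𝟙 _)
      (by rw [Category.comp_id, chartι_toSpec]) (by rw [Category.comp_id, chartι_toSpec])

instance : IsOpenImmersion (chartι f) := by
  unfold chartι
  infer_instance

theorem chartι_proj₁ : chartι f ≫ proj₁ k V =
    Spec.map (CommRingCat.ofHom Algebra.TensorProduct.includeLeftRingHom) ≫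
      Grassmannian.chartι (initial f) := by
  rw [chartι, Category.assoc, pullback.map, pullback.lift_fst, pullbackSpecIso_inv_fst_assoc]

theorem chartι_proj₂ : chartι f ≫ proj₂ k V =
    Spec.map (CommRingCat.ofHom (Algebra.TensorProduct.includeRight :
      chartRing f →ₐ[k] chartRing (initial f) ⊗[k] chartRing f).toRingHom) ≫
        Grassmannian.chartι f := by
  rw [chartι, Category.assoc, pullback.map, pullback.lift_snd, pullbackSpecIso_inv_snd_assoc]
  rfl

theorem mem_range_chartι_iff (x : ambient k V) : x ∈ Set.range (chartι f) ↔
    proj₁ k V x ∈ Set.range (Grassmannian.chartι (initial f)) ∧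
      proj₂ k V x ∈ Set.range (Grassmannian.chartι f) := by
  have h : Set.range (chartι f) = proj₁ k V ⁻¹' Set.range (Grassmannian.chartι (initial f)) ∩
      proj₂ k V ⁻¹' Set.range (Grassmannian.chartι f) :=
    (Function.Surjective.range_comp
      (pullbackSpecIso k (chartRing (initial f)) (chartRing f)).inv.homeomorph.surjective _).trans
      (Scheme.Pullback.range_map _ _ _ _ _ _ (𝟙 _) _ _)
  rw [h]
  rfl

/-- The set of closed points of the incidence variety in the chart. -/
theorem preimage_closedPoints : chartι f ⁻¹' closedPoints k V =
    evalPoint (tensorToFun (chartRing (initial f)).val (chartRing f).val) ''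
      incident six_le_eight f := by
  ext p
  have h₁ : proj₁ k V (chartι f p) = Grassmannian.chartι (initial f)
      (PrimeSpectrum.comap Algebra.TensorProduct.includeLeftRingHom p) := by
    rw [← Scheme.Hom.comp_apply, chartι_proj₁]
    rfl
  have h₂ : proj₂ k V (chartι f p) = Grassmannian.chartι f
      (PrimeSpectrum.comap (Algebra.TensorProduct.includeRight :
      chartRing f →ₐ[k] chartRing (initial f) ⊗[k] chartRing f).toRingHom p) := by
    rw [← Scheme.Hom.comp_apply, chartι_proj₂]
    rfl
  constructor
  · rintro ⟨R, W, hR, hW, hWR, hpR, hpW⟩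
    rw [h₁] at hpR
    rw [h₂] at hpW
    obtain ⟨v, hv, rfl⟩ := exists_frame_of_chartι_eq_point hR hpR
    obtain ⟨w, hw, rfl⟩ := exists_frame_of_chartι_eq_point hW hpW
    exact ⟨(v, w), hWR, (eq_evalPoint_of_comap_eq hv hw).symm⟩
  · rintro ⟨⟨v, w⟩, h, rfl⟩
    refine ⟨_, _, finrank_span_frame v, finrank_span_frame w, h, ?_, ?_⟩
    · rw [h₁, ← chartι_framePoint, comap_includeLeft_evalPoint]
      rfl
    · rw [h₂, ← chartι_framePoint, comap_includeRight_evalPoint]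
      rfl

theorem exists_flat_chart (s : Incidence.scheme k V) :
    ∃ (Z : Scheme.{u}) (φ : Z ⟶ Incidence.scheme k V), IsOpenImmersion φ ∧ s ∈ Set.range φ ∧
      Flat (φ ≫ toBase k V) := by
  obtain ⟨f, hf₁, hf₂⟩ := exists_mem_range_chartι six_le_eight (proj₁ k V (ι k V s))
    (proj₂ k V (ι k V s))
  have hs : ι k V s ∈ Set.range (chartι f) := (mem_range_chartι_iff f _).mpr ⟨hf₁, hf₂⟩
  obtain ⟨v₀⟩ := nonempty_frame_of_mem_range hf₁
  refine ReducedSubscheme.exists_flat_chart (α := (chartRing (initial f)).val)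
    (β := (chartRing f).val) Subtype.val_injective Subtype.val_injective
    (transport six_le_eight v₀) (comp_transport_mem six_le_eight v₀)
    (comp_transport_symm_mem six_le_eight v₀) {w | (v₀, w) ∈ incident six_le_eight f}
    (closedPoints k V) (proj₁ k V) (Grassmannian.chartι (initial f)) (chartι f) (chartι_proj₁ f)
    ?_ s hs
  rw [preimage_closedPoints]
  congr 1
  ext ⟨v, w⟩
  exact (transport_symm_mem_incident six_le_eight).symm

variable (k V) in
theorem flat_toBase : Flat (toBase k V) := by
  choose Z φ hφ hs hflat using exists_flat_chart (k := k) (V := V)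
  have : IsZariskiLocalAtSource @Flat :=
    HasRingHomProperty.instIsZariskiLocalAtSource (Q := RingHom.Flat)
  exact IsZariskiLocalAtSource.of_openCover
    (Scheme.Cover.mkOfCovers (P := @IsOpenImmersion) _ Z φ (fun s => ⟨s, hs s⟩) hφ) hflat

end Charts

end Incidence

end

theorem mainTheorem4 (k : Type u) [Field k] [IsAlgClosed k]
    (V : Type u) [AddCommGroup V] [Module k V] (hV : Module.finrank k V = 4) :
    AlgebraicGeometry.Flat (Incidence.toBase k V) := by
  have : Module.Finite k V := Module.finite_of_finrank_pos (by omega)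
  exact Incidence.flat_toBase k V
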